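/- Let $n\ge 2$, and let $\Gamma$ be a finite connected graph (a finite connected CW complex of dimension at most one; loops and multiple edges are allowed) whose Euler characteristic (number of vertices minus number of edges) is zero. Let $\mathbb{Z}_n$ act freely and continuously on $\Gamma$. Let $S^1\vee I$ be the wedge sum of the circle and the unit interval $I=[0,1]$ with base point $0$, that is, the graph with two vertices and two edges, exactly one of which is a loop. Say that a homotopy class $\alpha$ of maps $\Gamma\to S^1\vee I$ has the Borsuk--Ulam property if for every representative $f$ of $\alpha$ there are $x\in\Gamma$ and $h_1\neq h_2$ in $\mathbb{Z}_n$ with $f(h_1\cdot x)=f(h_2\cdot x)$. Then the Borsuk--Ulam property fails for every homotopy class in $[\Gamma,S^1\vee I]$: every class $\alpha$ has a representative $f$ with $f(h_1\cdot x)\neq f(h_2\cdot x)$ for all $x\in\Gamma$ and all $h_1\neq h_2$ in $\mathbb{Z}_n$. This holds both for free homotopy classes and, for every choice of base points $x_1\in\Gamma$ and $y_1\in S^1\vee I$, for based homotopy classes in $[\Gamma,x_1;S^1\vee I,y_1]$. -/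

import Mathlib

namespace BorsukUlam

open Topology

/-- A CW structure on the whole (Hausdorff) space `Γ` is a *finite graph* if it has finitely many
cells and no cell of dimension greater than one: the `0`-cells are the vertices and the `1`-cells
are the edges (loops and multiple edges are allowed). -/
class IsFiniteGraph (Γ : Type*) [TopologicalSpace Γ] [CWComplex (Set.univ : Set Γ)] : Prop
    extends RelCWComplex.Finite (Set.univ : Set Γ) where
  isEmpty_cell : ∀ k : ℕ, 2 ≤ k → IsEmpty (RelCWComplex.cell (Set.univ : Set Γ) k)

/-- The Euler characteristic of a finite graph: the number of vertices minus the number of edges. -/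
noncomputable def graphEulerChar (Γ : Type*) [TopologicalSpace Γ]
    [CWComplex (Set.univ : Set Γ)] : ℤ :=
  (Nat.card (RelCWComplex.cell (Set.univ : Set Γ) 0) : ℤ)
    - (Nat.card (RelCWComplex.cell (Set.univ : Set Γ) 1) : ℤ)

/-- The wedge sum of the pointed spaces `(X, x₀)` and `(Y, y₀)`, realised as the subspace
`X × {y₀} ∪ {x₀} × Y` of `X × Y`. -/
abbrev Wedge {X Y : Type*} (x₀ : X) (y₀ : Y) : Type _ :=
  {p : X × Y // p.2 = y₀ ∨ p.1 = x₀}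

/-- The graph `S¹ ∨ I`, where the unit interval has base point `0`. -/
abbrev CircleWedgeInterval : Type := Wedge (1 : Circle) (0 : unitInterval)

section HomotopyClasses

variable (X Y : Type*) [TopologicalSpace X] [TopologicalSpace Y]

/-- Homotopy as an equivalence relation on continuous maps. -/
def freeSetoid : Setoid C(X, Y) where
  r f g := f.Homotopic g
  iseqv := ContinuousMap.Homotopic.equivalence

/-- The set `[X, Y]` of free homotopy classes of continuous maps. -/
def FreeHomotopyClass : Type _ := Quotient (freeSetoid X Y)

variable {X Y}

/-- Base point preserving homotopy as an equivalence relation on the continuous maps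
`f : X → Y` with `f x₀ = y₀`. -/
def basedSetoid (x₀ : X) (y₀ : Y) : Setoid {f : C(X, Y) // f x₀ = y₀} where
  r f g := f.1.HomotopicRel g.1 {x₀}
  iseqv :=
    { refl := fun f => ContinuousMap.HomotopicRel.refl f.1
      symm := fun h => ContinuousMap.HomotopicRel.symm h
      trans := fun h h' => ContinuousMap.HomotopicRel.trans h h' }

/-- The set `[X, x₀; Y, y₀]` of based homotopy classes of continuous maps. -/
def BasedHomotopyClass (x₀ : X) (y₀ : Y) : Type _ := Quotient (basedSetoid x₀ y₀)

/-- The free homotopy class `α` has the Borsuk--Ulam property with respect to the action of `H`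
on `X`: no representative of `α` is injective along all the orbits. -/
def FreeHomotopyClass.HasBorsukUlam (H : Type*) [VAdd H X] (α : FreeHomotopyClass X Y) : Prop :=
  ∀ f : C(X, Y), (Quotient.mk (freeSetoid X Y) f : FreeHomotopyClass X Y) = α →
    ∃ h₁ h₂ : H, ∃ x : X, h₁ ≠ h₂ ∧ f (h₁ +ᵥ x) = f (h₂ +ᵥ x)

/-- The based homotopy class `α` has the Borsuk--Ulam property with respect to the action of `H`
on `X`: no representative of `α` is injective along all the orbits. -/
def BasedHomotopyClass.HasBorsukUlam (H : Type*) [VAdd H X] {x₀ : X} {y₀ : Y}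
    (α : BasedHomotopyClass x₀ y₀) : Prop :=
  ∀ f : {f : C(X, Y) // f x₀ = y₀},
    (Quotient.mk (basedSetoid x₀ y₀) f : BasedHomotopyClass x₀ y₀) = α →
      ∃ h₁ h₂ : H, ∃ x : X, h₁ ≠ h₂ ∧ f.1 (h₁ +ᵥ x) = f.1 (h₂ +ᵥ x)

end HomotopyClasses

end BorsukUlam

/-! ### Graphs as quotients of disjoint unions of vertices and intervals. -/

namespace BorsukUlam

open Set Topology

/-! Up to homotopy the interval attached to the circle is invisible, so a map `g` to the wedge is
determined by its circle coordinate modulo maps that lift to `ℝ`. As the Euler characteristic is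
zero and `Γ` is connected, maps to the circle modulo liftable ones form a cyclic group
(`exists_generator`), the integral first cohomology.

The action is free and `Γ` is one-dimensional, so there is a map `w` to `ℝ/ℤ` on which `h` acts as
addition of `h / n` (`exists_equivariant_map`): it is a map to the join of two copies of the group,
pushed to the circle. Such a `w` is never liftable. It follows that the group acts trivially on the
cyclic cohomology, and averaging makes a generator `φ` satisfy `φ (h + x) = φ x + a` with constants
`a`. Comparing with `w` shows `a ≠ 0` for `h ≠ 0` (`exists_equivariant_generator`).

It remains to treat the circle with its rotations of order dividing `n`. For each degree `k`,
`exists_wedge_map` constructs a map `F` from the circle to the wedge that separates the points of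
each coset of the `n`-torsion: the moving points use the interval to overtake each other, as a
vehicle does on a siding. If the circle coordinate of `g` is `k • φ` modulo liftable maps, then `F`
composed with a rotated `φ` is injective on orbits and homotopic to `g`
(`homotopicRel_of_circle_eq_mul_exp`). Surjectivity of `F` provides the rotation that matches the
values at the base point. -/

/-- A description of the space `Γ` as a graph: vertices `V`, edges `E` parametrised by the unit
interval, every edge being attached to the vertices `src e` and `tgt e`. -/
structure EdgePresentation (V E Γ : Type*) [TopologicalSpace Γ] where
  vert : V → Γ
  edge : E → C(unitInterval, Γ)
  src : E → V
  tgt : E → V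
  edge_zero : ∀ e, edge e 0 = vert (src e)
  edge_one : ∀ e, edge e 1 = vert (tgt e)
  cover : ∀ x, (∃ v, vert v = x) ∨ ∃ e, ∃ t ∈ Ioo (0 : unitInterval) 1, edge e t = x
  vert_injective : Function.Injective vert
  edge_inj : ∀ {e e' t t'}, t ∈ Ioo (0 : unitInterval) 1 → t' ∈ Ioo (0 : unitInterval) 1 →
    edge e t = edge e' t' → e = e' ∧ t = t'
  edge_ne_vert : ∀ {e t v}, t ∈ Ioo (0 : unitInterval) 1 → edge e t ≠ vert v

theorem unitInterval_cases (t : unitInterval) : t = 0 ∨ t = 1 ∨ t ∈ Ioo (0 : unitInterval) 1 := by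
  rcases eq_or_lt_of_le (unitInterval.nonneg' (t := t)) with h | h
  · exact Or.inl h.symm
  · rcases eq_or_lt_of_le (unitInterval.le_one' (t := t)) with h' | h'
    · exact Or.inr (Or.inl h')
    · exact Or.inr (Or.inr ⟨h, h'⟩)

namespace EdgePresentation

variable {V E Γ Z : Type*} [TopologicalSpace Γ] [TopologicalSpace Z] (P : EdgePresentation V E Γ)

theorem exists_edge_or_vert (x : Γ) : (∃ v, P.vert v = x) ∨ ∃ e t, P.edge e t = x := by
  rcases P.cover x with h | ⟨e, t, -, h⟩
  · exact Or.inl h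
  · exact Or.inr ⟨e, t, h⟩

/-- The map from the disjoint union of the vertices and the edges onto the graph. -/
def total : V ⊕ (E × unitInterval) → Γ := Sum.elim P.vert fun p => P.edge p.1 p.2

/-- A continuous surjection from a compact space to a Hausdorff space is closed, hence a quotient
map. -/
theorem isQuotientMap_total [T2Space Γ] [Finite V] [Finite E] [TopologicalSpace V]
    [DiscreteTopology V] [TopologicalSpace E] [DiscreteTopology E] : IsQuotientMap P.total := by
  have hc : Continuous P.total := by
    refine continuous_sum_dom.2 ⟨continuous_of_discreteTopology, ?_⟩
    exact continuous_prod_of_discrete_left.2 fun e => (P.edge e).continuous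
  refine IsClosedMap.isQuotientMap hc.isClosedMap hc fun x => ?_
  rcases P.exists_edge_or_vert x with ⟨v, h⟩ | ⟨e, t, h⟩
  · exact ⟨Sum.inl v, h⟩
  · exact ⟨Sum.inr (e, t), h⟩

theorem isOpen_iff [T2Space Γ] [Finite V] [Finite E] {U : Set Γ} :
    IsOpen U ↔ ∀ e, IsOpen (P.edge e ⁻¹' U) := by
  let _ : TopologicalSpace V := ⊥
  let _ : TopologicalSpace E := ⊥
  have : DiscreteTopology V := ⟨rfl⟩
  have : DiscreteTopology E := ⟨rfl⟩
  refine ⟨fun h e => h.preimage (P.edge e).continuous, fun h => ?_⟩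
  rw [← P.isQuotientMap_total.isOpen_preimage, isOpen_sum_iff]
  refine ⟨isOpen_discrete _, ?_⟩
  rw [show (Sum.inr ⁻¹' (P.total ⁻¹' U) : Set (E × unitInterval))
    = ⋃ e, ({e} ×ˢ (P.edge e ⁻¹' U)) by ext ⟨e, t⟩; simp [total]]
  exact isOpen_iUnion fun e => (isOpen_discrete _).prod (h e)

/-- The only identifications in the quotient occur at ends of edges, where compatibility is assumed.
-/
theorem exists_glue [T2Space Γ] [Finite V] [Finite E] (a : V → Z) (b : E → C(unitInterval, Z))
    (h0 : ∀ e, b e 0 = a (P.src e)) (h1 : ∀ e, b e 1 = a (P.tgt e)) :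
    ∃ F : C(Γ, Z), (∀ v, F (P.vert v) = a v) ∧ ∀ e t, F (P.edge e t) = b e t := by
  let _ : TopologicalSpace V := ⊥
  let _ : TopologicalSpace E := ⊥
  have : DiscreteTopology V := ⟨rfl⟩
  have : DiscreteTopology E := ⟨rfl⟩
  let q : C(V ⊕ (E × unitInterval), Γ) := ⟨P.total, P.isQuotientMap_total.continuous⟩
  let g : C(V ⊕ (E × unitInterval), Z) := ⟨Sum.elim a fun p => b p.1 p.2,
    continuous_sum_dom.2 ⟨continuous_of_discreteTopology,
      continuous_prod_of_discrete_left.2 fun e => (b e).continuous⟩⟩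
  have key : ∀ e t v, P.edge e t = P.vert v → b e t = a v := by
    intro e t v h
    rcases unitInterval_cases t with rfl | rfl | ht
    · rw [h0, P.vert_injective ((P.edge_zero e).symm.trans h)]
    · rw [h1, P.vert_injective ((P.edge_one e).symm.trans h)]
    · exact absurd h (P.edge_ne_vert ht)
  have key2 : ∀ e t e' t', P.edge e t = P.edge e' t' → b e t = b e' t' := by
    intro e t e' t' h
    rcases unitInterval_cases t' with rfl | rfl | ht'
    · rw [h0, key]; rw [h, P.edge_zero]
    · rw [h1, key]; rw [h, P.edge_one]
    rcases unitInterval_cases t with rfl | rfl | ht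
    · exact absurd (h.symm.trans (P.edge_zero e)) (P.edge_ne_vert ht')
    · exact absurd (h.symm.trans (P.edge_one e)) (P.edge_ne_vert ht')
    · obtain ⟨rfl, rfl⟩ := P.edge_inj ht ht' h
      rfl
  have hq : IsQuotientMap q := P.isQuotientMap_total
  have hfac : Function.FactorsThrough g q := by
    rintro (v | ⟨e, t⟩) (v' | ⟨e', t'⟩) h
    · exact congrArg a (P.vert_injective h)
    · exact (key e' t' v h.symm).symm
    · exact key e t v' h
    · exact key2 e t e' t' h
  refine ⟨hq.lift g hfac, fun v => ?_, fun e t => ?_⟩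
  · exact DFunLike.congr_fun (hq.lift_comp g hfac) (Sum.inl v)
  · exact DFunLike.congr_fun (hq.lift_comp g hfac) (Sum.inr (e, t))

/-- On a connected graph, a function on the vertices that agrees at the two ends of every edge is
constant. -/
theorem eq_of_src_eq_tgt [T2Space Γ] [PreconnectedSpace Γ] [Finite V] [Finite E] {A : Type*}
    (a : V → A) (h : ∀ e, a (P.src e) = a (P.tgt e)) (v w : V) : a v = a w := by
  let _ : TopologicalSpace A := ⊥
  have : DiscreteTopology A := ⟨rfl⟩
  obtain ⟨F, hF, -⟩ := P.exists_glue a (fun e => ContinuousMap.const _ (a (P.src e)))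
    (fun e => rfl) (fun e => h e)
  rw [← hF, ← hF]
  exact PreconnectedSpace.constant ‹_› F.continuous

theorem nonempty_vert {V E Γ : Type*} [TopologicalSpace Γ] (P : EdgePresentation V E Γ)
    [Nonempty Γ] : Nonempty V := by
  obtain ⟨x⟩ := ‹Nonempty Γ›
  rcases P.exists_edge_or_vert x with ⟨v, -⟩ | ⟨e, -⟩
  exacts [⟨v⟩, ⟨P.src e⟩]

end EdgePresentation

/-! ### From CW structures to edge presentations. -/

/-- The affine parametrisation of the one-dimensional ball by the unit interval. -/
def ballParam (t : unitInterval) : Fin 1 → ℝ := fun _ => 2 * (t : ℝ) - 1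

theorem continuous_ballParam : Continuous ballParam := by
  unfold ballParam; fun_prop

theorem ballParam_mem_closedBall (t : unitInterval) :
    ballParam t ∈ Metric.closedBall (0 : Fin 1 → ℝ) 1 := by
  have h0 := t.2.1
  have h1 := t.2.2
  rw [mem_closedBall_zero_iff, pi_norm_le_iff_of_nonneg zero_le_one]
  intro i
  rw [Real.norm_eq_abs, abs_le]
  constructor <;> simp only [ballParam] <;> linarith

theorem ballParam_mem_ball {t : unitInterval} (ht : t ∈ Ioo (0 : unitInterval) 1) :
    ballParam t ∈ Metric.ball (0 : Fin 1 → ℝ) 1 := by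
  have h0 : (0 : ℝ) < t := ht.1
  have h1 : (t : ℝ) < 1 := ht.2
  rw [mem_ball_zero_iff, pi_norm_lt_iff zero_lt_one]
  intro i
  rw [Real.norm_eq_abs, abs_lt]
  constructor <;> simp only [ballParam] <;> linarith

theorem ballParam_mem_sphere {t : unitInterval} (ht : t = 0 ∨ t = 1) :
    ballParam t ∈ Metric.sphere (0 : Fin 1 → ℝ) 1 := by
  rw [mem_sphere_zero_iff_norm]
  rcases ht with rfl | rfl
  · rw [show ballParam 0 = fun _ => (-1 : ℝ) by ext; simp [ballParam], pi_norm_const]; simp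
  · rw [show ballParam 1 = fun _ => (1 : ℝ) by ext; simp [ballParam]; norm_num, pi_norm_const]
    simp

theorem ballParam_injective : Function.Injective ballParam := by
  intro s t h
  have := congrFun h 0
  simp only [ballParam] at this
  exact Subtype.ext (by linarith)

theorem exists_ballParam_eq {y : Fin 1 → ℝ} (hy : y ∈ Metric.closedBall (0 : Fin 1 → ℝ) 1) :
    ∃ t, ballParam t = y := by
  rw [mem_closedBall_zero_iff, pi_norm_le_iff_of_nonneg zero_le_one] at hy
  have := hy 0
  rw [Real.norm_eq_abs, abs_le] at this
  refine ⟨⟨(y 0 + 1) / 2, by linarith, by linarith⟩, ?_⟩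
  ext i
  rw [Subsingleton.elim i 0]
  simp only [ballParam]
  ring

section CW

variable (Γ : Type*) [TopologicalSpace Γ] [CWComplex (univ : Set Γ)]

local notation "cellΓ" => RelCWComplex.cell (univ : Set Γ)

/-- The point given by a `0`-cell. -/
def cellPoint (v : cellΓ 0) : Γ := RelCWComplex.map 0 v 0

variable {Γ}

theorem openCell_zero (v : cellΓ 0) : RelCWComplex.openCell 0 v = {cellPoint Γ v} := by
  ext x
  simp only [RelCWComplex.openCell, mem_image, mem_singleton_iff, cellPoint]
  constructor
  · rintro ⟨y, -, rfl⟩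
    rw [Subsingleton.elim y 0]
  · rintro rfl
    exact ⟨0, by simp, rfl⟩

theorem closedCell_zero (v : cellΓ 0) : RelCWComplex.closedCell 0 v = {cellPoint Γ v} := by
  ext x
  simp only [RelCWComplex.closedCell, mem_image, mem_singleton_iff, cellPoint]
  constructor
  · rintro ⟨y, -, rfl⟩
    rw [Subsingleton.elim y 0]
  · rintro rfl
    exact ⟨0, by simp, rfl⟩

theorem exists_cellPoint_eq (e : cellΓ 1) {y : Fin 1 → ℝ}
    (hy : y ∈ Metric.sphere (0 : Fin 1 → ℝ) 1) :
    ∃ v : cellΓ 0, RelCWComplex.map 1 e y = cellPoint Γ v := by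
  obtain ⟨I, hI⟩ := CWComplex.mapsTo (C := (univ : Set Γ)) 1 e
  have := hI hy
  simp only [mem_iUnion] at this
  obtain ⟨m, hm, j, -, hj⟩ := this
  obtain rfl : m = 0 := by omega
  have : RelCWComplex.map 1 e y ∈ RelCWComplex.closedCell 0 j := hj
  rw [closedCell_zero] at this
  exact ⟨j, this⟩

/-- The characteristic map of a `1`-cell as a map on the unit interval. -/
def cellPath (e : cellΓ 1) : C(unitInterval, Γ) where
  toFun t := RelCWComplex.map 1 e (ballParam t)
  continuous_toFun := by
    have := (RelCWComplex.continuousOn 1 e).comp_continuous continuous_ballParam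
      ballParam_mem_closedBall
    exact this

theorem cellPath_mem_openCell (e : cellΓ 1) {t : unitInterval} (ht : t ∈ Ioo (0 : unitInterval) 1) :
    cellPath e t ∈ RelCWComplex.openCell 1 e :=
  ⟨_, ballParam_mem_ball ht, rfl⟩

theorem exists_edgePresentation [IsFiniteGraph Γ] :
    Nonempty (EdgePresentation (cellΓ 0) (cellΓ 1) Γ) := by
  choose s hs using fun e : cellΓ 1 =>
    exists_cellPoint_eq e (ballParam_mem_sphere (t := 0) (Or.inl rfl))
  choose t ht using fun e : cellΓ 1 =>
    exists_cellPoint_eq e (ballParam_mem_sphere (t := 1) (Or.inr rfl))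
  refine ⟨⟨cellPoint Γ, cellPath, s, t, hs, ht, ?_, ?_, ?_, ?_⟩⟩
  · intro x
    have hx : x ∈ ⋃ (n : ℕ) (j : cellΓ n), RelCWComplex.closedCell n j := by
      rw [CWComplex.union]; trivial
    simp only [mem_iUnion] at hx
    obtain ⟨n, j, hj⟩ := hx
    match n, j, hj with
    | 0, j, hj =>
      rw [closedCell_zero] at hj
      exact Or.inl ⟨j, hj.symm⟩
    | 1, j, hj =>
      obtain ⟨y, hy, rfl⟩ := hj
      obtain ⟨r, rfl⟩ := exists_ballParam_eq hy
      rcases unitInterval_cases r with rfl | rfl | hr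
      · exact Or.inl ⟨_, (hs j).symm⟩
      · exact Or.inl ⟨_, (ht j).symm⟩
      · exact Or.inr ⟨j, r, hr, rfl⟩
    | n + 2, j, hj =>
      exact ((IsFiniteGraph.isEmpty_cell (Γ := Γ) (n + 2) (by omega)).false j).elim
  · intro v w h
    apply RelCWComplex.openCell_congr
    rw [openCell_zero, openCell_zero, h]
  · intro e e' r r' hr hr' h
    have he : e = e' := by
      by_contra hne
      have hd := RelCWComplex.disjoint_openCell_of_ne (C := (univ : Set Γ))
        (i := e) (j := e') (by simpa using hne)
      exact disjoint_left.1 hd (cellPath_mem_openCell e hr) (h ▸ cellPath_mem_openCell e' hr')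
    subst he
    refine ⟨rfl, ballParam_injective ?_⟩
    refine (RelCWComplex.map 1 e).injOn ?_ ?_ h
    · rw [RelCWComplex.source_eq]; exact ballParam_mem_ball hr
    · rw [RelCWComplex.source_eq]; exact ballParam_mem_ball hr'
  · intro e r v hr h
    have hd := RelCWComplex.disjoint_openCell_of_ne (C := (univ : Set Γ)) (n := 1) (m := 0)
        (i := e) (j := v) (by simp)
    refine disjoint_left.1 hd (cellPath_mem_openCell e hr) ?_
    rw [openCell_zero]
    exact h

end CW

end BorsukUlam

/-! ### Maps to the circle modulo liftable maps: the cyclic first cohomology. -/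

namespace BorsukUlam

open Set Topology

/-- The maps to the circle that lift to the real line. -/
def liftable (Γ : Type*) [TopologicalSpace Γ] : AddSubgroup C(Γ, UnitAddCircle) where
  carrier := {u | ∃ θ : C(Γ, ℝ), ∀ x, u x = (θ x : UnitAddCircle)}
  zero_mem' := ⟨0, fun x => by simp⟩
  add_mem' := by
    rintro u u' ⟨θ, h⟩ ⟨θ', h'⟩
    exact ⟨θ + θ', fun x => by simp [h, h']⟩
  neg_mem' := by
    rintro u ⟨θ, h⟩
    exact ⟨-θ, fun x => by simp [h]⟩

theorem exists_real_lift (γ : C(unitInterval, UnitAddCircle)) (a : ℝ)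
    (ha : (a : UnitAddCircle) = γ 0) :
    ∃ l : C(unitInterval, ℝ), l 0 = a ∧ ∀ t, (l t : UnitAddCircle) = γ t := by
  have cov := AddCircle.isCoveringMap_coe (1 : ℝ)
  refine ⟨cov.liftPath γ a ha.symm, cov.liftPath_zero .., fun t => ?_⟩
  exact congrFun (cov.liftPath_lifts γ a ha.symm) t

theorem exists_injective_functional {M : Type*} [AddCommGroup M] [Module ℚ M]
    [FiniteDimensional ℚ M] (h : Module.finrank ℚ M ≤ 1) :
    ∃ f : M →ₗ[ℚ] ℚ, Function.Injective f := by
  rcases Nat.le_one_iff_eq_zero_or_eq_one.1 h with h | h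
  · have := Module.finrank_zero_iff.1 h
    exact ⟨0, Function.injective_of_subsingleton _⟩
  · let f := LinearEquiv.ofFinrankEq (R := ℚ) M ℚ (by simpa using h)
    exact ⟨f.toLinearMap, f.injective⟩

namespace EdgePresentation

variable {V E Γ : Type*} [TopologicalSpace Γ] (P : EdgePresentation V E Γ)

/-- The coboundary map on rational cochains. -/
def coboundary : (V → ℚ) →ₗ[ℚ] (E → ℚ) where
  toFun m e := m (P.tgt e) - m (P.src e)
  map_add' m m' := by ext e; simp; ring
  map_smul' c m := by ext e; simp; ring

/-- The quotient is the first rational cohomology. By connectedness the kernel of the coboundary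
consists of constants, and rank-nullity gives dimension `|E| - |V| + dim ker`. -/
theorem finrank_quotient_coboundary_le [T2Space Γ] [ConnectedSpace Γ] [Finite V] [Finite E]
    (h : Nat.card E ≤ Nat.card V) :
    Module.finrank ℚ ((E → ℚ) ⧸ LinearMap.range P.coboundary) ≤ 1 := by
  have := Fintype.ofFinite V
  have := Fintype.ofFinite E
  have hker : Module.finrank ℚ (LinearMap.ker P.coboundary) ≤ 1 := by
    refine finrank_le_one ⟨fun _ => 1, ?_⟩ ?_
    · ext e; simp [coboundary]
    · rintro ⟨m, hm⟩
      obtain ⟨v⟩ := P.nonempty_vert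
      refine ⟨m v, ?_⟩
      ext w
      change m v * 1 = m w
      rw [mul_one]
      refine P.eq_of_src_eq_tgt m (fun e => ?_) v w
      have := congrFun (LinearMap.mem_ker.1 hm) e
      simp only [coboundary, LinearMap.coe_mk, AddHom.coe_mk, Pi.zero_apply] at this
      linarith
  have h1 := LinearMap.finrank_range_add_finrank_ker P.coboundary
  have h2 := Submodule.finrank_quotient_add_finrank (LinearMap.range P.coboundary)
  rw [Module.finrank_fintype_fun_eq_card, ← Nat.card_eq_fintype_card] at h1 h2
  omega

/-- An injective functional on rational cohomology, with denominators cleared, detects integral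
classes because an integral cochain that is a rational coboundary is an integral one. -/
theorem exists_cocycle_functional [T2Space Γ] [ConnectedSpace Γ] [Finite V] [Finite E]
    (h : Nat.card E ≤ Nat.card V) :
    ∃ F : (E → ℤ) →+ ℤ, ∀ z, F z = 0 → ∃ m : V → ℤ, ∀ e, z e = m (P.tgt e) - m (P.src e) := by
  classical
  have := Fintype.ofFinite E
  obtain ⟨f, hf⟩ := exists_injective_functional (P.finrank_quotient_coboundary_le h)
  obtain ⟨b, hb⟩ := IsLocalization.exist_integer_multiples_of_finite (nonZeroDivisors ℤ)
    (fun e : E => f (Submodule.Quotient.mk (Pi.single e 1)))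
  choose c hc using hb
  have hb0 : ((b : ℤ) : ℚ) ≠ 0 := by exact_mod_cast nonZeroDivisors.ne_zero b.2
  let F : (E → ℤ) →+ ℤ :=
    { toFun := fun z => ∑ e, z e * c e
      map_zero' := by simp
      map_add' := fun z z' => by simp [add_mul, Finset.sum_add_distrib] }
  have hF : ∀ z : E → ℤ, ((F z : ℤ) : ℚ) = b * f (Submodule.Quotient.mk fun e => (z e : ℚ)) := by
    intro z
    have hz : (fun e => (z e : ℚ)) = ∑ e, (z e : ℚ) • Pi.single e (1 : ℚ) := by
      ext e
      simp [Finset.sum_apply, Pi.single_apply]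
    have : f (Submodule.Quotient.mk fun e => (z e : ℚ))
        = ∑ e, (z e : ℚ) * f (Submodule.Quotient.mk (Pi.single e (1 : ℚ))) := by
      rw [hz, ← Submodule.mkQ_apply, map_sum, map_sum]
      simp
    rw [this, Finset.mul_sum]
    simp only [F, AddMonoidHom.coe_mk, ZeroHom.coe_mk, Int.cast_sum, Int.cast_mul]
    refine Finset.sum_congr rfl fun e _ => ?_
    have := hc e
    simp only [eq_intCast, zsmul_eq_mul] at this
    rw [this]
    ring
  refine ⟨F, fun z hz => ?_⟩
  have h0 : f (Submodule.Quotient.mk fun e => (z e : ℚ)) = 0 := by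
    have := hF z
    rw [hz, Int.cast_zero] at this
    exact (mul_eq_zero.1 this.symm).resolve_left hb0
  rw [map_eq_zero_iff f hf, Submodule.Quotient.mk_eq_zero] at h0
  obtain ⟨m, hm⟩ := h0
  have hm' : ∀ e, m (P.tgt e) - m (P.src e) = z e := fun e => congrFun hm e
  -- The rational potential changes by integers along edges, so replacing it by its floor leaves all
  -- the differences unchanged.
  have hfr : ∀ e, Int.fract (m (P.src e)) = Int.fract (m (P.tgt e)) := fun e => by
    rw [Int.fract_eq_fract]
    exact ⟨-z e, by push_cast; linarith [hm' e]⟩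
  refine ⟨fun v => ⌊m v⌋, fun e => ?_⟩
  have h1 := hm' e
  have h2 := hfr e
  simp only [Int.fract] at h2
  have : ((z e : ℤ) : ℚ) = ((⌊m (P.tgt e)⌋ - ⌊m (P.src e)⌋ : ℤ) : ℚ) := by
    push_cast
    linarith
  exact_mod_cast this

/-- Pairs of a map to the circle and an integral cocycle measuring the obstruction to lifting it,
relative to chosen lifts at the vertices. -/
def liftCocycles : AddSubgroup (C(Γ, UnitAddCircle) × (E → ℤ)) where
  carrier := {p | ∃ (θ : V → ℝ) (l : E → C(unitInterval, ℝ)),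
    (∀ v, (θ v : UnitAddCircle) = p.1 (P.vert v)) ∧
    (∀ e t, (l e t : UnitAddCircle) = p.1 (P.edge e t)) ∧
    (∀ e, l e 0 = θ (P.src e)) ∧ ∀ e, l e 1 = θ (P.tgt e) + p.2 e}
  zero_mem' := ⟨0, 0, by simp⟩
  add_mem' := by
    rintro p p' ⟨θ, l, h1, h2, h3, h4⟩ ⟨θ', l', h1', h2', h3', h4'⟩
    refine ⟨θ + θ', l + l', ?_, ?_, ?_, ?_⟩
    · intro v; simp [h1, h1']
    · intro v; simp [h2, h2']
    · intro v; simp [h3, h3']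
    · intro v; simp [h4, h4']; ring
  neg_mem' := by
    rintro p ⟨θ, l, h1, h2, h3, h4⟩
    refine ⟨-θ, -l, ?_, ?_, ?_, ?_⟩
    · intro v; simp [h1]
    · intro v; simp [h2]
    · intro v; simp [h3]
    · intro v; simp [h4]; ring

/-- Lift at the vertices arbitrarily, then lift each edge starting from its source; the mismatch at
the target is an integer. -/
theorem exists_liftCocycle (u : C(Γ, UnitAddCircle)) : ∃ z, (u, z) ∈ P.liftCocycles := by
  choose θ hθ using fun v => QuotientAddGroup.mk_surjective (u (P.vert v))
  choose l hl0 hl using fun e => exists_real_lift (u.comp (P.edge e)) (θ (P.src e))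
    (by rw [ContinuousMap.comp_apply, P.edge_zero]; exact hθ _)
  have key : ∀ e, ∃ k : ℤ, l e 1 = θ (P.tgt e) + k := by
    intro e
    have h1 : ((l e 1 - θ (P.tgt e) : ℝ) : UnitAddCircle) = 0 := by
      rw [AddCircle.coe_sub, hl, ContinuousMap.comp_apply, P.edge_one, sub_eq_zero]
      exact (hθ _).symm
    obtain ⟨k, hk⟩ := AddCircle.coe_eq_zero_iff _ |>.1 h1
    refine ⟨k, ?_⟩
    simp only [zsmul_eq_mul, mul_one] at hk
    linarith
  choose z hz using key
  exact ⟨z, θ, l, hθ, fun e t => hl e t, hl0, hz⟩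

/-- When the obstruction is a coboundary, shifting the vertex lifts by the integers `m` makes the
edge lifts fit together. -/
theorem mem_liftable_of_liftCocycle [T2Space Γ] [Finite V] [Finite E] {u : C(Γ, UnitAddCircle)}
    {z : E → ℤ} (hu : (u, z) ∈ P.liftCocycles) {m : V → ℤ}
    (hm : ∀ e, z e = m (P.tgt e) - m (P.src e)) : u ∈ liftable Γ := by
  obtain ⟨θ, l, h1, h2, h3, h4⟩ := hu
  have hint : ∀ k : ℤ, ((k : ℝ) : UnitAddCircle) = 0 := fun k =>
    (AddCircle.coe_eq_zero_iff _).2 ⟨k, by simp⟩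
  obtain ⟨F, hF, hF'⟩ := P.exists_glue (fun v => θ v + m v)
    (fun e => l e + ContinuousMap.const _ (m (P.src e) : ℝ)) (fun e => by simp [h3])
    (fun e => by simp [h4, hm, add_assoc])
  refine ⟨F, fun x => ?_⟩
  rcases P.exists_edge_or_vert x with ⟨v, rfl⟩ | ⟨e, t, rfl⟩
  · rw [hF, AddCircle.coe_add, hint, add_zero, h1]
  · rw [hF', ContinuousMap.add_apply, ContinuousMap.const_apply, AddCircle.coe_add, hint, add_zero,
      h2]

/-- The functional sends the obstruction cocycles onto a subgroup of `ℤ`, which is cyclic; a map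
realising its generator works, since a cocycle killed by the functional is a coboundary. -/
theorem exists_generator {V E Γ : Type*} [TopologicalSpace Γ] (P : EdgePresentation V E Γ)
    [T2Space Γ] [ConnectedSpace Γ] [Finite V] [Finite E]
    (h : Nat.card E ≤ Nat.card V) :
    ∃ u : C(Γ, UnitAddCircle), ∀ u₀ : C(Γ, UnitAddCircle), ∃ k : ℤ, u₀ - k • u ∈ liftable Γ := by
  obtain ⟨F, hF⟩ := P.exists_cocycle_functional h
  obtain ⟨g, hg⟩ := Int.subgroup_cyclic
    (P.liftCocycles.map (F.comp (AddMonoidHom.snd C(Γ, UnitAddCircle) (E → ℤ))))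
  have hg' : g ∈ P.liftCocycles.map (F.comp (AddMonoidHom.snd C(Γ, UnitAddCircle) (E → ℤ))) := by
    rw [hg]
    exact AddSubgroup.subset_closure rfl
  obtain ⟨⟨u, z⟩, hu, huz⟩ := hg'
  refine ⟨u, fun u₀ => ?_⟩
  obtain ⟨z₀, h₀⟩ := P.exists_liftCocycle u₀
  have h₁ : F z₀ ∈ AddSubgroup.closure {g} := by
    rw [← hg]
    exact ⟨(u₀, z₀), h₀, rfl⟩
  obtain ⟨k, hk⟩ := AddSubgroup.mem_closure_singleton.1 h₁
  have h₂ : (u₀ - k • u, z₀ - k • z) ∈ P.liftCocycles :=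
    P.liftCocycles.sub_mem h₀ (P.liftCocycles.zsmul_mem hu k)
  obtain ⟨m, hm⟩ := hF (z₀ - k • z) (by
    rw [map_sub, map_zsmul, ← hk, sub_eq_zero, ← huz]
    rfl)
  exact ⟨k, P.mem_liftable_of_liftCocycle h₂ hm⟩

end EdgePresentation

end BorsukUlam

/-! ### Equivariant colorings and their join. -/

namespace BorsukUlam

open Set Topology Filter

section Coloring

variable {n : ℕ} [NeZero n] {X : Type*} [TopologicalSpace X] [AddAction (ZMod n) X]

/-- The largest invariant subset of `B`. -/
def invariantCore (n : ℕ) {X : Type*} [AddAction (ZMod n) X] (B : Set X) : Set X :=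
  {x | ∀ h : ZMod n, h +ᵥ x ∈ B}

omit [NeZero n] [TopologicalSpace X] in
theorem vadd_mem_invariantCore_iff {B : Set X} {x : X} (h : ZMod n) :
    h +ᵥ x ∈ invariantCore n B ↔ x ∈ invariantCore n B := by
  refine ⟨fun hx k => ?_, fun hx k => ?_⟩
  · have := hx (k - h)
    rwa [vadd_vadd, sub_add_cancel] at this
  · rw [vadd_vadd]
    exact hx _

theorem isOpen_invariantCore [ContinuousConstVAdd (ZMod n) X] {B : Set X} (hB : IsOpen B) :
    IsOpen (invariantCore n B) := by
  rw [show invariantCore n B = ⋂ h : ZMod n, (fun x => h +ᵥ x) ⁻¹' B by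
    ext; simp [invariantCore]]
  exact isOpen_iInter_of_finite fun h => hB.preimage (continuous_const_vadd h)

/-- A disjoint family of open sets, none of which meets its nontrivial translates, gives a
locally constant equivariant map to the group on the largest invariant subset of its union. -/
theorem exists_equivariant_coloring [ContinuousConstVAdd (ZMod n) X] {J : Type*} (A : J → Set X)
    (hA : ∀ j, IsOpen (A j)) (hd : ∀ i j x, x ∈ A i → x ∈ A j → i = j)
    (hs : ∀ j x (h : ZMod n), x ∈ A j → h +ᵥ x ∈ A j → h = 0) :
    ∃ c : X → ZMod n, ∀ x ∈ invariantCore n (⋃ j, A j),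
      (∀ h : ZMod n, c (h +ᵥ x) = h + c x) ∧ ∀ᶠ y in 𝓝 x, c y = c x := by
  classical
  let σ : X → Option J := fun x => if H : ∃ j, x ∈ A j then some H.choose else none
  have hσ : ∀ {x j}, x ∈ A j → σ x = some j := by
    intro x j hx
    have H : ∃ j, x ∈ A j := ⟨j, hx⟩
    simp only [σ, dif_pos H]
    rw [hd _ _ _ H.choose_spec hx]
  -- The itinerary of `x` records which set each point of the orbit lies in. Translating `x` shifts
  -- the itinerary, so fixing one representative per shift class turns an itinerary into a group
  -- element, the shift `κ` carrying it to the representative.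
  let τ : X → ZMod n → Option J := fun x h => σ (h +ᵥ x)
  let S : Setoid (ZMod n → Option J) :=
    { r := fun f g => ∃ k, ∀ h, g h = f (h + k)
      iseqv :=
        { refl := fun f => ⟨0, by simp⟩
          symm := by
            rintro f g ⟨k, hk⟩
            exact ⟨-k, fun h => by rw [hk, neg_add_cancel_right]⟩
          trans := by
            rintro f g l ⟨k, hk⟩ ⟨k', hk'⟩
            exact ⟨k' + k, fun h => by rw [hk', hk, add_assoc]⟩ } }
  let rep : (ZMod n → Option J) → ZMod n → Option J := fun f => (Quotient.mk S f).out
  have hrep : ∀ f, ∃ k, ∀ h, f h = rep f (h + k) := fun f => Quotient.mk_out (s := S) f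
  choose κ hκ using hrep
  refine ⟨fun x => κ (τ x), fun x hx => ⟨fun k => ?_, ?_⟩⟩
  · have hshift : ∀ h, τ (k +ᵥ x) h = τ x (h + k) := fun h => by simp only [τ, vadd_vadd]
    have hrepeq : rep (τ (k +ᵥ x)) = rep (τ x) :=
      congrArg Quotient.out (Quotient.sound (s := S) ⟨-k, fun h => by
        rw [hshift, neg_add_cancel_right]⟩)
    -- On the invariant core an itinerary is injective, so the shift `κ` is unique there; this
    -- forces equivariance.
    have hfree : ∀ h h', τ x h = τ x h' → h = h' := by
      intro h h' heq
      obtain ⟨j, hj⟩ := mem_iUnion.1 (hx h)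
      obtain ⟨j', hj'⟩ := mem_iUnion.1 (hx h')
      simp only [τ, hσ hj, hσ hj', Option.some.injEq] at heq
      subst heq
      refine sub_eq_zero.1 (hs j (h' +ᵥ x) (h - h') hj' ?_)
      rwa [vadd_vadd, sub_add_cancel]
    have h1 := hκ (τ (k +ᵥ x)) (-κ (τ (k +ᵥ x)))
    have h2 := hκ (τ x) (-κ (τ x))
    rw [hrepeq, hshift] at h1
    rw [neg_add_cancel] at h1 h2
    have := hfree _ _ (h1.trans h2.symm)
    calc κ (τ (k +ᵥ x)) = k - (-κ (τ (k +ᵥ x)) + k) := by abel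
      _ = k + κ (τ x) := by rw [this]; abel
  -- The itinerary is determined by finitely many memberships in open sets, hence is locally
  -- constant.
  · have : ∀ᶠ y in 𝓝 x, ∀ h, τ y h = τ x h := by
      rw [eventually_all]
      intro h
      obtain ⟨j, hj⟩ := mem_iUnion.1 (hx h)
      filter_upwards [((hA j).preimage (continuous_const_vadd h)).mem_nhds hj] with y hy
      simp only [τ]
      rw [hσ hj, hσ hy]
    filter_upwards [this] with y hy
    rw [show τ y = τ x from funext hy]

/-- Averaging an ordinary Urysohn function over the finite group keeps its values on invariant sets.
-/
theorem exists_invariant_urysohn [ContinuousConstVAdd (ZMod n) X] [NormalSpace X] {s t : Set X}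
    (hs : IsClosed s) (ht : IsClosed t) (hst : Disjoint s t)
    (his : ∀ (h : ZMod n), ∀ x ∈ s, h +ᵥ x ∈ s) (hit : ∀ (h : ZMod n), ∀ x ∈ t, h +ᵥ x ∈ t) :
    ∃ ρ : C(X, ℝ), (∀ x ∈ s, ρ x = 0) ∧ (∀ x ∈ t, ρ x = 1) ∧
      ∀ (h : ZMod n) x, ρ (h +ᵥ x) = ρ x := by
  obtain ⟨f, hf0, hf1, -⟩ := exists_continuous_zero_one_of_isClosed hs ht hst
  have hn : (n : ℝ) ≠ 0 := NeZero.ne _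
  refine ⟨⟨fun x => (∑ h : ZMod n, f (h +ᵥ x)) / n, ?_⟩, fun x hx => ?_, fun x hx => ?_,
    fun k x => ?_⟩
  · refine Continuous.div_const (continuous_finsetSum _ fun h _ => ?_) _
    exact f.continuous.comp (continuous_const_vadd h)
  · simp [fun h : ZMod n => hf0 (his h x hx)]
  · simp [fun h : ZMod n => hf1 (hit h x hx), hn]
  · simp only [ContinuousMap.coe_mk, vadd_vadd]
    congr 1
    exact Equiv.sum_comp (Equiv.addRight k) fun h => f (h +ᵥ x)

/-- Two locally constant equivariant maps to `ZMod n`, defined on open invariant sets covering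
the space, are joined to an equivariant map to the circle. -/
theorem exists_equivariant_join [ContinuousConstVAdd (ZMod n) X] [NormalSpace X] {D D' : Set X}
    (hD : IsOpen D) (hD' : IsOpen D') (hcov : ∀ x, x ∈ D ∨ x ∈ D')
    (hiD : ∀ (h : ZMod n) x, h +ᵥ x ∈ D ↔ x ∈ D) (hiD' : ∀ (h : ZMod n) x, h +ᵥ x ∈ D' ↔ x ∈ D')
    (c c' : X → ZMod n)
    (hc : ∀ x ∈ D, (∀ h : ZMod n, c (h +ᵥ x) = h + c x) ∧ ∀ᶠ y in 𝓝 x, c y = c x)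
    (hc' : ∀ x ∈ D', (∀ h : ZMod n, c' (h +ᵥ x) = h + c' x) ∧ ∀ᶠ y in 𝓝 x, c' y = c' x) :
    ∃ w : C(X, UnitAddCircle), ∀ (h : ZMod n) x, w (h +ᵥ x) = ZMod.toAddCircle h + w x := by
  obtain ⟨ρ, hρ0, hρ1, hρ⟩ := exists_invariant_urysohn (n := n) hD'.isClosed_compl hD.isClosed_compl
    (disjoint_left.2 fun x h1 h2 => (hcov x).elim h2 h1)
    (fun h x hx => mt (hiD' h x).1 hx) (fun h x hx => mt (hiD h x).1 hx)
  -- A bounded real lift of the difference of the two colors. It is invariant where both colorings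
  -- are equivariant, since only the difference enters.
  let m : X → ℝ := fun x => ((c' x - c x).val : ℝ) / n
  have hm : ∀ x, ((m x : ℝ) : UnitAddCircle) = ZMod.toAddCircle (c' x) - ZMod.toAddCircle (c x) :=
    fun x => by rw [← map_sub, ZMod.toAddCircle_apply]
  have hn : (0 : ℝ) < n := by exact_mod_cast NeZero.pos n
  have hmb : ∀ x, |m x| ≤ 1 := fun x => by
    have : ((c' x - c x).val : ℝ) ≤ n := by exact_mod_cast (ZMod.val_lt _).le
    rw [abs_of_nonneg (by positivity)]
    exact (div_le_one hn).2 this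
  -- Interpolates from the color `c` at `ρ = 0` to `c'` at `ρ = 1`. Outside `D` the value of `c` is
  -- meaningless, but there `ρ = 1` and the form `hw'` no longer involves it.
  let w : X → UnitAddCircle := fun x => ZMod.toAddCircle (c x) + ((ρ x * m x : ℝ) : UnitAddCircle)
  have hw' : ∀ x, w x = ZMod.toAddCircle (c' x) - (((1 - ρ x) * m x : ℝ) : UnitAddCircle) := by
    intro x
    rw [sub_mul, one_mul, AddCircle.coe_sub, hm]
    simp only [w]
    abel
  -- At points lying in only one of the two sets, `m` may jump, but it is bounded and multiplied by
  -- a factor tending to `0`.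
  have hsmall : ∀ (f : X → ℝ) x, ContinuousAt f x → f x = 0 →
      Tendsto (fun y => ((f y * m y : ℝ) : UnitAddCircle)) (𝓝 x) (𝓝 0) := by
    intro f x hf h0
    have h1 : Tendsto (fun y => f y * m y) (𝓝 x) (𝓝 0) := by
      refine squeeze_zero_norm (a := fun y => |f y|) (fun y => ?_) ?_
      · rw [norm_mul, Real.norm_eq_abs, Real.norm_eq_abs]
        exact mul_le_of_le_one_right (abs_nonneg _) (hmb y)
      · have := hf.abs
        rw [ContinuousAt, h0, abs_zero] at this
        exact this
    exact (AddCircle.continuous_mk' 1).tendsto' 0 0 (by simp) |>.comp h1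
  refine ⟨⟨w, continuous_iff_continuousAt.2 fun x => ?_⟩, fun h x => ?_⟩
  · by_cases hx : x ∈ D
    · by_cases hx' : x ∈ D'
      · have : w =ᶠ[𝓝 x] fun y =>
            ZMod.toAddCircle (c x) + ((ρ y * m x : ℝ) : UnitAddCircle) := by
          filter_upwards [(hc x hx).2, (hc' x hx').2] with y hy hy'
          simp only [w, m, hy, hy']
        refine ContinuousAt.congr ?_ this.symm
        exact (continuous_const.add ((AddCircle.continuous_mk' 1).comp
          (ρ.continuous.mul continuous_const))).continuousAt
      · have h0 := hρ0 x hx'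
        have h1 := hsmall ρ x ρ.continuous.continuousAt h0
        have : w =ᶠ[𝓝 x] fun y =>
            ZMod.toAddCircle (c x) + ((ρ y * m y : ℝ) : UnitAddCircle) := by
          filter_upwards [(hc x hx).2] with y hy
          simp only [w, hy]
        refine Tendsto.congr' this.symm ?_
        have h2 := h1.const_add (ZMod.toAddCircle (c x))
        simpa only [w, h0, zero_mul, AddCircle.coe_zero] using h2
    · have hx' := (hcov x).resolve_left hx
      have h0 : (1 : ℝ) - ρ x = 0 := by rw [hρ1 x hx, sub_self]
      have h1 := hsmall (fun y => 1 - ρ y) x (by fun_prop) h0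
      have : w =ᶠ[𝓝 x] fun y =>
          ZMod.toAddCircle (c' x) - (((1 - ρ y) * m y : ℝ) : UnitAddCircle) := by
        filter_upwards [(hc' x hx').2] with y hy
        rw [hw', hy]
      refine Tendsto.congr' this.symm ?_
      have h2 := h1.const_sub (ZMod.toAddCircle (c' x))
      simpa only [hw' x, h0, zero_mul, AddCircle.coe_zero] using h2
  · change w (h +ᵥ x) = _ + w x
    by_cases hx : x ∈ D
    · by_cases hx' : x ∈ D'
      · simp only [w, m, (hc x hx).1, (hc' x hx').1, hρ, map_add, add_sub_add_left_eq_sub, add_assoc]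
      · simp only [w, (hc x hx).1, hρ, hρ0 x hx', map_add, add_assoc, zero_mul]
    · have hx' := (hcov x).resolve_left hx
      simp only [hw', (hc' x hx').1, hρ, hρ1 x hx, map_add, sub_self, zero_mul, add_sub_assoc]

theorem exists_open_disjoint_translates [ContinuousConstVAdd (ZMod n) X] [T2Space X]
    (hfree : ∀ (h : ZMod n) (x : X), h +ᵥ x = x → h = 0) (x : X) :
    ∃ W, IsOpen W ∧ x ∈ W ∧ ∀ (h : ZMod n), ∀ y ∈ W, h +ᵥ y ∈ W → h = 0 := by
  have : ∀ h : ZMod n, ∃ U, IsOpen U ∧ x ∈ U ∧ ∀ y ∈ U, h +ᵥ y ∈ U → h = 0 := by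
    intro h
    by_cases hh : h = 0
    · exact ⟨univ, isOpen_univ, trivial, fun _ _ _ => hh⟩
    · obtain ⟨u, v, hu, hv, hxu, hxv, huv⟩ := t2_separation fun he => hh (hfree h x he)
      refine ⟨v ∩ (fun y => h +ᵥ y) ⁻¹' u, hv.inter (hu.preimage (continuous_const_vadd h)),
        ⟨hxv, hxu⟩, fun y hy hy' => (disjoint_left.1 huv hy.2 hy'.1).elim⟩
  choose U hU hxU hUs using this
  refine ⟨⋂ h, U h, isOpen_iInter_of_finite hU, mem_iInter.2 hxU, fun h y hy hy' => ?_⟩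
  exact hUs h y (mem_iInter.1 hy h) (mem_iInter.1 hy' h)

end Coloring

/-! ### Subdivided graphs and the equivariant map to the circle. -/

namespace EdgePresentation

variable {V E Γ : Type*} [TopologicalSpace Γ] (P : EdgePresentation V E Γ)

theorem preimage_edge_image_Ioo (e : E) (a b : unitInterval) (e' : E) :
    IsOpen (P.edge e' ⁻¹' (P.edge e '' Ioo a b)) := by
  have hsub : ∀ t ∈ Ioo a b, t ∈ Ioo (0 : unitInterval) 1 := fun t ht =>
    ⟨lt_of_le_of_lt unitInterval.nonneg' ht.1, lt_of_lt_of_le ht.2 unitInterval.le_one'⟩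
  have key : ∀ s ∈ P.edge e' ⁻¹' (P.edge e '' Ioo a b), e = e' ∧ s ∈ Ioo a b := by
    rintro s ⟨t, ht, hts⟩
    rcases unitInterval_cases s with rfl | rfl | hs
    · exact (P.edge_ne_vert (hsub t ht) (hts.trans (P.edge_zero e'))).elim
    · exact (P.edge_ne_vert (hsub t ht) (hts.trans (P.edge_one e'))).elim
    · obtain ⟨rfl, rfl⟩ := P.edge_inj (hsub t ht) hs hts
      exact ⟨rfl, ht⟩
  by_cases he : e = e'
  · subst he
    rw [show P.edge e ⁻¹' (P.edge e '' Ioo a b) = Ioo a b from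
      Subset.antisymm (fun s hs => (key s hs).2) (subset_preimage_image _ _)]
    exact isOpen_Ioo
  · rw [show P.edge e' ⁻¹' (P.edge e '' Ioo a b) = ∅ from
      eq_empty_of_forall_notMem fun s hs => he (key s hs).1]
    exact isOpen_empty

/-- A graph minus a suitable finite set is a disjoint union of open sets that are small with
respect to a given open cover. -/
theorem exists_subdivision {V E Γ : Type*} [TopologicalSpace Γ] (P : EdgePresentation V E Γ)
    [T2Space Γ] [Finite V] [Finite E] (W : Γ → Set Γ)
    (hW : ∀ x, IsOpen (W x)) (hxW : ∀ x, x ∈ W x) :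
    ∃ (F : Set Γ) (A : E × ℕ → Set Γ), F.Finite ∧ (∀ j, IsOpen (A j)) ∧
      (∀ i j x, x ∈ A i → x ∈ A j → i = j) ∧ (∀ j, ∃ x, A j ⊆ W x) ∧
      ∀ x, x ∈ F ∨ x ∈ ⋃ j, A j := by
  have := fun e => exists_monotone_Icc_subset_open_cover_unitInterval
    (c := fun x => P.edge e ⁻¹' W x) (fun x => (hW x).preimage (P.edge e).continuous)
    (fun s _ => mem_iUnion.2 ⟨P.edge e s, hxW _⟩)
  choose t ht0 htm ht1 htW using this
  choose N hN using ht1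
  have hsub : ∀ e k, ∀ s ∈ Ioo (t e k) (t e (k + 1)), s ∈ Ioo (0 : unitInterval) 1 :=
    fun e k s hs =>
      ⟨lt_of_le_of_lt unitInterval.nonneg' hs.1, lt_of_lt_of_le hs.2 unitInterval.le_one'⟩
  refine ⟨range P.vert ∪ ⋃ e, P.edge e '' range (t e),
    fun p => P.edge p.1 '' Ioo (t p.1 p.2) (t p.1 (p.2 + 1)), ?_, ?_, ?_, ?_, ?_⟩
  · refine (finite_range _).union (finite_iUnion fun e => Finite.image _ ?_)
    refine ((finite_Iic (N e)).image (t e)).subset ?_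
    rintro _ ⟨k, rfl⟩
    rcases le_total k (N e) with h | h
    · exact ⟨k, h, rfl⟩
    · exact ⟨N e, mem_Iic.2 le_rfl, by rw [hN e k h, hN e _ le_rfl]⟩
  · exact fun j => P.isOpen_iff.2 (P.preimage_edge_image_Ioo _ _ _)
  · rintro ⟨e, k⟩ ⟨e', k'⟩ x ⟨s, hs, rfl⟩ ⟨s', hs', h⟩
    obtain ⟨rfl, rfl⟩ := P.edge_inj (hsub _ _ _ hs') (hsub _ _ _ hs) h
    by_contra hne
    have hk : k ≠ k' := fun hk => hne (by rw [hk])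
    exact disjoint_left.1 ((htm e').pairwise_disjoint_on_Ioo_succ hk) hs hs'
  · rintro ⟨e, k⟩
    obtain ⟨x, hx⟩ := htW e k
    exact ⟨x, image_subset_iff.2 (Ioo_subset_Icc_self.trans hx)⟩
  · intro x
    by_contra! hx
    obtain ⟨hF, hA⟩ := hx
    rcases P.cover x with ⟨v, rfl⟩ | ⟨e, s, hs, rfl⟩
    · exact hF (Or.inl ⟨v, rfl⟩)
    -- The first subdivision point beyond `s` has a predecessor, which is at most `s`; equality
    -- would put the point in the finite set.
    · have hex : ∃ m, s < t e m := ⟨N e, by rw [hN e _ le_rfl]; exact hs.2⟩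
      classical
      obtain ⟨k, hk⟩ : ∃ k, Nat.find hex = k + 1 := by
        refine Nat.exists_eq_succ_of_ne_zero fun h0 => ?_
        have := Nat.find_spec hex
        rw [h0, ht0] at this
        exact absurd this (not_lt.2 unitInterval.nonneg')
      have h1 : s < t e (k + 1) := hk ▸ Nat.find_spec hex
      have h2 : t e k ≤ s := not_lt.1 (Nat.find_min hex (by omega))
      refine hA (mem_iUnion.2 ⟨(e, k), s, ⟨lt_of_le_of_ne h2 fun heq => ?_, h1⟩, rfl⟩)
      exact hF (Or.inr (mem_iUnion.2 ⟨e, s, ⟨k, heq⟩, rfl⟩))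

theorem compactSpace {V E Γ : Type*} [TopologicalSpace Γ] (P : EdgePresentation V E Γ)
    [T2Space Γ] [Finite V] [Finite E] : CompactSpace Γ := by
  let _ : TopologicalSpace V := ⊥
  let _ : TopologicalSpace E := ⊥
  have : DiscreteTopology V := ⟨rfl⟩
  have : DiscreteTopology E := ⟨rfl⟩
  have h := P.isQuotientMap_total
  exact ⟨h.surjective.range_eq ▸ isCompact_range h.continuous⟩

/-- One-dimensionality enters here: two colored invariant open sets suffice to cover the graph, one
avoiding a finite set of subdivision points and the other surrounding it. Each comes from disjoint
open pieces small enough to miss their nontrivial translates. -/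
theorem exists_equivariant_map {V E Γ : Type*} [TopologicalSpace Γ] (P : EdgePresentation V E Γ)
    [T2Space Γ] [Finite V] [Finite E] {n : ℕ} [NeZero n]
    [AddAction (ZMod n) Γ] [ContinuousConstVAdd (ZMod n) Γ]
    (hfree : ∀ (h : ZMod n) (x : Γ), h +ᵥ x = x → h = 0) :
    ∃ w : C(Γ, UnitAddCircle), ∀ (h : ZMod n) x, w (h +ᵥ x) = ZMod.toAddCircle h + w x := by
  have := P.compactSpace
  choose W hW hxW hWs using exists_open_disjoint_translates hfree
  obtain ⟨F, A, hF, hA, hAd, hAW, hcov⟩ := P.exists_subdivision W hW hxW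
  -- Saturating makes the finite set invariant, so every orbit lies entirely in it or entirely
  -- outside it, and thus in one of the two invariant cores.
  let F' : Set Γ := {x | ∃ h : ZMod n, h +ᵥ x ∈ F}
  have hF' : F'.Finite := by
    rw [show F' = ⋃ h : ZMod n, (fun x => h +ᵥ x) ⁻¹' F by ext; simp [F']]
    exact finite_iUnion fun h => hF.preimage (AddAction.injective h).injOn
  obtain ⟨U, hU, hUd⟩ := hF'.t2_separation
  obtain ⟨c, hc⟩ := exists_equivariant_coloring (n := n) A hA hAd (fun j x h hx hx' => by
    obtain ⟨y, hy⟩ := hAW j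
    exact hWs y h x (hy hx) (hy hx'))
  obtain ⟨c', hc'⟩ := exists_equivariant_coloring (n := n) (fun p : F' => U p ∩ W p)
    (fun p => (hU p).2.inter (hW p))
    (fun p q x hp hq => by
      by_contra hne
      exact disjoint_left.1 (hUd p.2 q.2 fun h => hne (Subtype.ext h)) hp.1 hq.1)
    (fun p x h hx hx' => hWs p h x hx.2 hx'.2)
  refine exists_equivariant_join (isOpen_invariantCore (isOpen_iUnion hA))
    (isOpen_invariantCore (isOpen_iUnion fun p : F' => (hU p).2.inter (hW p))) (fun x => ?_)
    (fun h x => vadd_mem_invariantCore_iff h) (fun h x => vadd_mem_invariantCore_iff h) c c' hc hc'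
  by_cases hx : x ∈ F'
  · refine Or.inr fun h => ?_
    have hh : h +ᵥ x ∈ F' := by
      obtain ⟨k, hk⟩ := hx
      exact ⟨k - h, by rwa [vadd_vadd, sub_add_cancel]⟩
    exact mem_iUnion.2 ⟨⟨_, hh⟩, (hU _).1, hxW _⟩
  · refine Or.inl fun h => (hcov _).resolve_left fun hh => hx ⟨h, hh⟩

end EdgePresentation

end BorsukUlam

/-! ### Homotopies of maps into the wedge. -/

namespace BorsukUlam

open Set Topology Filter

section WedgeHomotopy

variable {Γ : Type*} [TopologicalSpace Γ]

theorem homotopicRel_of_continuous {Y : Type*} [TopologicalSpace Y] {f g : C(Γ, Y)} {S : Set Γ}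
    (H : unitInterval × Γ → Y) (hH : Continuous H) (h0 : ∀ x, H (0, x) = f x)
    (h1 : ∀ x, H (1, x) = g x) (hS : ∀ t, ∀ x ∈ S, H (t, x) = f x) : f.HomotopicRel g S :=
  ⟨{ toFun := H
     continuous_toFun := hH
     map_zero_left := h0
     map_one_left := h1
     prop' := hS }⟩

/-- Maps to the wedge with the same circle coordinate, the second being nowhere further out on the
interval than the first, are homotopic. -/
theorem homotopicRel_of_le {f g : C(Γ, CircleWedgeInterval)} {S : Set Γ}
    (hu : ∀ x, (g x).1.1 = (f x).1.1) (hv : ∀ x, (g x).1.2 ≤ (f x).1.2)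
    (hS : ∀ x ∈ S, g x = f x) : f.HomotopicRel g S := by
  have hmem : ∀ p : unitInterval × Γ,
      (1 - (p.1 : ℝ)) * ((f p.2).1.2 : ℝ) + (p.1 : ℝ) * ((g p.2).1.2 : ℝ) ∈ unitInterval := fun p =>
    convex_Icc (0 : ℝ) 1 (f p.2).1.2.2 (g p.2).1.2.2 (unitInterval.one_minus_nonneg _)
      p.1.2.1 (by ring)
  refine homotopicRel_of_continuous
    (fun p => ⟨((f p.2).1.1, ⟨_, hmem p⟩), ?_⟩) ?_ ?_ ?_ ?_
  · rcases (f p.2).2 with h | h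
    · left
      have h' : (g p.2).1.2 = 0 := le_antisymm ((hv p.2).trans h.le) unitInterval.nonneg'
      ext
      simp [h, h']
    · exact Or.inr h
  · refine Continuous.subtype_mk (Continuous.prodMk ?_ (Continuous.subtype_mk ?_ _)) _ <;> fun_prop
  · intro x
    ext <;> simp
  · intro x
    ext <;> simp [hu]
  · intro t x hx
    have hx := hS x hx
    ext
    · simp
    · simp only [hx]
      ring

/-- Maps to the wedge with the same interval coordinate whose circle coordinates differ by the
exponential of a real function vanishing off the circle are homotopic. -/
theorem homotopicRel_of_exp {f g : C(Γ, CircleWedgeInterval)} {S : Set Γ} (θ : C(Γ, ℝ))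
    (hu : ∀ x, (g x).1.1 = (f x).1.1 * Circle.exp (θ x)) (hv : ∀ x, (g x).1.2 = (f x).1.2)
    (hθ : ∀ x, (f x).1.2 ≠ 0 → θ x = 0) (hS : ∀ x ∈ S, θ x = 0) : f.HomotopicRel g S := by
  refine homotopicRel_of_continuous
    (fun p => ⟨((f p.2).1.1 * Circle.exp (p.1 * θ p.2), (f p.2).1.2), ?_⟩) ?_ ?_ ?_ ?_
  · by_cases h : (f p.2).1.2 = 0
    · exact Or.inl h
    · right
      simp [hθ _ h, (f p.2).2.resolve_left h]
  · refine Continuous.subtype_mk (Continuous.prodMk ?_ ?_) _ <;> fun_prop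
  · intro x
    ext <;> simp
  · intro x
    ext <;> simp [hu, hv]
  · intro t x hx
    ext <;> simp [hS x hx]

/-- Maps to the wedge whose circle coordinates differ by the exponential of a real function are
homotopic, relative to the points where they agree and this function vanishes. -/
theorem homotopicRel_of_circle_eq_mul_exp {f g : C(Γ, CircleWedgeInterval)} {S : Set Γ}
    (θ : C(Γ, ℝ)) (h : ∀ x, (g x).1.1 = (f x).1.1 * Circle.exp (θ x))
    (hS : ∀ x ∈ S, θ x = 0 ∧ f x = g x) : f.HomotopicRel g S := by
  classical
  -- A common lower height: both maps are lowered to it, and there the rotation by `θ` takes place,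
  -- since `θ` vanishes wherever the height is positive. Taking the minimum instead of `0` keeps the
  -- points of `S` fixed.
  let m : Γ → unitInterval := fun x => if θ x = 0 then min (f x).1.2 (g x).1.2 else 0
  have hmf : ∀ x, m x ≤ (f x).1.2 := fun x => by
    simp only [m]; split_ifs
    exacts [min_le_left _ _, unitInterval.nonneg']
  have hmg : ∀ x, m x ≤ (g x).1.2 := fun x => by
    simp only [m]; split_ifs
    exacts [min_le_right _ _, unitInterval.nonneg']
  have hfc : Continuous fun x => (f x).1.2 := by fun_prop
  have hgc : Continuous fun x => (g x).1.2 := by fun_prop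
  have hmin : Continuous fun x => min (f x).1.2 (g x).1.2 := hfc.min hgc
  have hmc : Continuous m := by
    refine continuous_iff_continuousAt.2 fun x => ?_
    by_cases hx : θ x = 0
    · by_cases h0 : min (f x).1.2 (g x).1.2 = 0
      · have hmx : m x = 0 := by simp only [m, if_pos hx, h0]
        rw [ContinuousAt, hmx]
        have hlim := hmin.tendsto x
        rw [h0] at hlim
        refine tendsto_of_tendsto_of_tendsto_of_le_of_le tendsto_const_nhds hlim
          (fun y => unitInterval.nonneg')
          fun y => le_min (hmf y) (hmg y)
      · have hpos : 0 < min (f x).1.2 (g x).1.2 := unitInterval.pos_iff_ne_zero.2 h0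
        -- Near `x` both heights are positive, so both circle coordinates are `1` and `θ` takes
        -- values in `2πℤ`; being small, it vanishes.
        have hev : ∀ᶠ y in 𝓝 x, θ y = 0 := by
          have h1 : ∀ᶠ y in 𝓝 x, |θ y| < 1 := by
            have : ContinuousAt (fun y => |θ y|) x := by fun_prop
            exact this.eventually_lt continuousAt_const (by simp [hx])
          filter_upwards [(hmin.tendsto x).eventually (lt_mem_nhds hpos), h1] with y hy hy1
          have hf1 := (f y).2.resolve_left (lt_of_lt_of_le hy (min_le_left _ _)).ne'
          have hg1 := (g y).2.resolve_left (lt_of_lt_of_le hy (min_le_right _ _)).ne'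
          have hexp := h y
          rw [hf1, hg1, one_mul, eq_comm, Circle.exp_eq_one] at hexp
          obtain ⟨k, hk⟩ := hexp
          rcases eq_or_ne k 0 with rfl | hk0
          · simpa using hk
          · exfalso
            have hk1 : (1 : ℝ) ≤ |(k : ℝ)| := by exact_mod_cast Int.one_le_abs hk0
            rw [hk, abs_mul, abs_of_pos Real.two_pi_pos] at hy1
            nlinarith [Real.pi_gt_three]
        refine hmin.continuousAt.congr ?_
        filter_upwards [hev] with y hy
        simp only [m, if_pos hy]
    · refine (continuousAt_const (y := (0 : unitInterval))).congr ?_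
      filter_upwards [θ.continuous.continuousAt.eventually_ne hx] with y hy
      simp only [m, if_neg hy]
  have hle : ∀ {a b : unitInterval}, a ≤ b → b = 0 → a = 0 := fun hab hb =>
    le_antisymm (hb ▸ hab) unitInterval.nonneg'
  let f' : C(Γ, CircleWedgeInterval) := ⟨fun x => ⟨((f x).1.1, m x),
    (f x).2.imp (hle (hmf x)) id⟩, by
      refine Continuous.subtype_mk (Continuous.prodMk ?_ hmc) _; fun_prop⟩
  let g' : C(Γ, CircleWedgeInterval) := ⟨fun x => ⟨((g x).1.1, m x),
    (g x).2.imp (hle (hmg x)) id⟩, by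
      refine Continuous.subtype_mk (Continuous.prodMk ?_ hmc) _; fun_prop⟩
  have hm : ∀ x ∈ S, m x = (f x).1.2 ∧ m x = (g x).1.2 := by
    intro x hxS
    obtain ⟨hx, hfg⟩ := hS x hxS
    simp only [m, if_pos hx, hfg, min_self, and_self]
  have h1 : f.HomotopicRel f' S :=
    homotopicRel_of_le (fun x => rfl) hmf fun x hx =>
      Subtype.ext (Prod.ext rfl (hm x hx).1)
  have h3 : g.HomotopicRel g' S :=
    homotopicRel_of_le (fun x => rfl) hmg fun x hx =>
      Subtype.ext (Prod.ext rfl (hm x hx).2)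
  have h2 : f'.HomotopicRel g' S := by
    refine homotopicRel_of_exp θ h (fun x => rfl) (fun x hx => ?_) fun x hx => (hS x hx).1
    by_contra hne
    exact hx (if_neg hne)
  exact (h1.trans h2).trans h3.symm

end WedgeHomotopy

end BorsukUlam

/-! ### The group action on maps to the circle; an equivariant generator. -/

namespace BorsukUlam

open Set Topology Filter

section Circle

variable {Γ : Type*} [TopologicalSpace Γ] [ConnectedSpace Γ]

/-- Countable subsets of a metric space are totally disconnected. -/
theorem exists_eq_const_of_countable {M : Type*} [MetricSpace M] {s : Set M} (hs : s.Countable)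
    (f : C(Γ, M)) (hf : ∀ x, f x ∈ s) : ∃ c, ∀ x, f x = c := by
  obtain ⟨x₀⟩ := (inferInstance : Nonempty Γ)
  exact ⟨f x₀, fun x => hs.isTotallyDisconnected (range f) (range_subset_iff.2 hf)
    (isPreconnected_range f.continuous) ⟨x, rfl⟩ ⟨x₀, rfl⟩⟩

theorem exists_eq_const_of_coe_eq (f : C(Γ, ℝ)) (a : UnitAddCircle)
    (hf : ∀ x, (f x : UnitAddCircle) = a) : ∃ c, ∀ x, f x = c := by
  obtain ⟨r, rfl⟩ := QuotientAddGroup.mk_surjective a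
  refine exists_eq_const_of_countable (countable_range fun k : ℤ => r + k) f fun x => ?_
  have h : ((f x - r : ℝ) : UnitAddCircle) = 0 := by
    rw [AddCircle.coe_sub, hf, sub_eq_zero]
  obtain ⟨k, hk⟩ := (AddCircle.coe_eq_zero_iff _).1 h
  exact ⟨k, by simp only [zsmul_eq_mul, mul_one] at hk; linarith⟩

omit [ConnectedSpace Γ] in
theorem const_mem_liftable {u : C(Γ, UnitAddCircle)} {a : UnitAddCircle} (h : ∀ x, u x = a) :
    u ∈ liftable Γ := by
  obtain ⟨r, rfl⟩ := QuotientAddGroup.mk_surjective a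
  exact ⟨ContinuousMap.const _ r, h⟩

/-- Torsion-freeness of cohomology: if `θ` lifts `m • u`, then `u - θ / m` takes values in the
finite `m`-torsion of the circle, so it is constant. -/
theorem mem_liftable_of_zsmul_mem {m : ℤ} (hm : m ≠ 0) {u : C(Γ, UnitAddCircle)}
    (h : m • u ∈ liftable Γ) : u ∈ liftable Γ := by
  obtain ⟨θ, hθ⟩ := h
  let η : C(Γ, UnitAddCircle) :=
    ⟨fun x => ((θ x / m : ℝ) : UnitAddCircle), (AddCircle.continuous_mk' 1).comp (by fun_prop)⟩
  have hη : η ∈ liftable Γ := ⟨⟨fun x => θ x / m, by fun_prop⟩, fun x => rfl⟩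
  have hm' : (m : ℝ) ≠ 0 := by exact_mod_cast hm
  obtain ⟨c, hc⟩ := exists_eq_const_of_countable
    (AddCircle.finite_torsion (1 : ℝ) (Int.natAbs_pos.2 hm)).countable (u - η) fun x => by
      rw [mem_ofPred_eq, natAbs_nsmul_eq_zero]
      change m • (u x - ((θ x / m : ℝ) : UnitAddCircle)) = 0
      rw [smul_sub, ← AddCircle.coe_zsmul, zsmul_eq_mul, mul_div_cancel₀ _ hm', ← hθ]
      exact sub_self _
  have := (liftable Γ).add_mem (const_mem_liftable hc) hη
  rwa [sub_add_cancel] at this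

variable {n : ℕ} [NeZero n] [AddAction (ZMod n) Γ] [ContinuousConstVAdd (ZMod n) Γ]

omit [TopologicalSpace Γ] [ConnectedSpace Γ] [NeZero n] [ContinuousConstVAdd (ZMod n) Γ] in
theorem apply_nsmul_vadd {A : Type*} [AddCommGroup A] {f : Γ → A} {h : ZMod n} {a : A}
    (hf : ∀ x, f (h +ᵥ x) = f x + a) (j : ℕ) (x : Γ) : f ((j • h) +ᵥ x) = f x + j • a := by
  induction j with
  | zero => simp
  | succ j ih => rw [succ_nsmul', ← vadd_vadd, hf, ih, succ_nsmul, add_assoc]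

omit [TopologicalSpace Γ] [ConnectedSpace Γ] [ContinuousConstVAdd (ZMod n) Γ] [NeZero n] in
theorem nsmul_eq_zero_of_vadd [Nonempty Γ] {A : Type*} [AddCommGroup A] {f : Γ → A} {h : ZMod n}
    {a : A} (hf : ∀ x, f (h +ᵥ x) = f x + a) : n • a = 0 := by
  obtain ⟨x⟩ := ‹Nonempty Γ›
  have := apply_nsmul_vadd hf n x
  rw [nsmul_eq_mul, CharP.cast_eq_zero, zero_mul, zero_vadd] at this
  exact left_eq_add.1 this

/-- A real function changes by an integer only, when translated by an element of finite order, as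
soon as the change is constant modulo the integers. -/
theorem eq_zero_of_coe_vadd (θ : C(Γ, ℝ)) {h : ZMod n} {a : UnitAddCircle}
    (hθ : ∀ x, (θ (h +ᵥ x) : UnitAddCircle) = θ x + a) : a = 0 := by
  obtain ⟨c, hc⟩ := exists_eq_const_of_coe_eq
    ⟨fun x => θ (h +ᵥ x) - θ x, (θ.continuous.comp (continuous_const_vadd h)).sub θ.continuous⟩ a
    fun x => by simp [hθ]
  have hc' : ∀ x, θ (h +ᵥ x) = θ x + c := fun x => by
    have := hc x
    simp only [ContinuousMap.coe_mk] at this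
    linarith
  have h0 : c = 0 := by
    have := nsmul_eq_zero_of_vadd hc'
    rwa [nsmul_eq_mul, mul_eq_zero, or_iff_right (NeZero.ne _)] at this
  obtain ⟨x⟩ := (inferInstance : Nonempty Γ)
  have := hθ x
  rw [hc' x, h0, add_zero] at this
  exact left_eq_add.1 this

/-- Translation of a map by a group element. -/
def translate (h : ZMod n) (u : C(Γ, UnitAddCircle)) : C(Γ, UnitAddCircle) :=
  u.comp ⟨fun x => h +ᵥ x, continuous_const_vadd h⟩

omit [ConnectedSpace Γ] [NeZero n] in
theorem translate_mem_liftable (h : ZMod n) {u : C(Γ, UnitAddCircle)} (hu : u ∈ liftable Γ) :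
    translate h u ∈ liftable Γ := by
  obtain ⟨θ, hθ⟩ := hu
  exact ⟨θ.comp ⟨fun x => h +ᵥ x, continuous_const_vadd h⟩, fun x => hθ _⟩

variable {w u : C(Γ, UnitAddCircle)}

/-- A real lift would change by a constant under translation by `1`; finite order makes this
constant zero, whereas `w` changes by `1 / n`. -/
theorem equivariant_notMem_liftable (hn : 2 ≤ n)
    (hw : ∀ (h : ZMod n) x, w (h +ᵥ x) = ZMod.toAddCircle h + w x) : w ∉ liftable Γ := by
  rintro ⟨θ, hθ⟩
  have h0 : ZMod.toAddCircle (1 : ZMod n) = 0 :=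
    eq_zero_of_coe_vadd θ fun x => by rw [← hθ, ← hθ, hw, add_comm]
  have : Fact (1 < n) := ⟨hn⟩
  exact one_ne_zero (ZMod.toAddCircle_eq_zero.1 h0)

/-- Modulo liftable maps, translation multiplies the generator `u` by some `m` and fixes the class
`k • u` of `w`. Hence `k * (m - 1)` kills `u`; as the class of `w` is nonzero and there is no
torsion, `m = 1`. -/
theorem translate_sub_mem_liftable (hn : 2 ≤ n)
    (hw : ∀ (h : ZMod n) x, w (h +ᵥ x) = ZMod.toAddCircle h + w x)
    (hu : ∀ u₀ : C(Γ, UnitAddCircle), ∃ k : ℤ, u₀ - k • u ∈ liftable Γ) (h : ZMod n) :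
    translate h u - u ∈ liftable Γ := by
  have hwL := equivariant_notMem_liftable hn hw
  obtain ⟨m, hm⟩ := hu (translate h u)
  obtain ⟨k, hk⟩ := hu w
  have h3 : translate h w - w ∈ liftable Γ :=
    const_mem_liftable (a := ZMod.toAddCircle h) fun x => by
      change w (h +ᵥ x) - w x = _
      rw [hw, add_sub_cancel_right]
  have h4 : translate h w - k • translate h u ∈ liftable Γ := translate_mem_liftable h hk
  have h5 : (k * (m - 1)) • u ∈ liftable Γ := by
    have := (liftable Γ).add_mem ((liftable Γ).sub_mem h3 h4)
      ((liftable Γ).sub_mem hk ((liftable Γ).zsmul_mem hm k))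
    convert this using 1
    module
  by_cases h0 : k * (m - 1) = 0
  · rcases mul_eq_zero.1 h0 with rfl | h1
    · exact (hwL (by simpa using hk)).elim
    · obtain rfl : m = 1 := by omega
      simpa using hm
  · refine (hwL ?_).elim
    have := (liftable Γ).add_mem hk
      ((liftable Γ).zsmul_mem (mem_liftable_of_zsmul_mem h0 h5) k)
    rwa [sub_add_cancel] at this

/-- A map to the circle all of whose translates differ from it by real functions can be averaged
to a map whose translates differ from it by constants. -/
theorem exists_averaged_map (hu : ∀ h : ZMod n, translate h u - u ∈ liftable Γ) :
    ∃ φ : C(Γ, UnitAddCircle), φ - u ∈ liftable Γ ∧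
      ∀ h : ZMod n, ∃ a, ∀ x, φ (h +ᵥ x) = φ x + a := by
  choose ψ hψ using hu
  have hψ' : ∀ h x, (ψ h x : UnitAddCircle) = u (h +ᵥ x) - u x := fun h x => (hψ h x).symm
  have hn : (n : ℝ) ≠ 0 := NeZero.ne _
  -- Adding the mean of the lifts `ψ h` of the differences to `u` amounts to averaging the
  -- translates of `u`, which cannot be done in the circle itself.
  let β : C(Γ, ℝ) := ⟨fun x => (∑ h, ψ h x) / n, by fun_prop⟩
  let β' : C(Γ, UnitAddCircle) := ⟨fun x => (β x : UnitAddCircle),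
    (AddCircle.continuous_mk' 1).comp β.continuous⟩
  refine ⟨u + β', ⟨β, fun x => ?_⟩, fun g => ?_⟩
  · rw [add_sub_cancel_left]
    rfl
  -- The real lifts satisfy the cocycle relation modulo integers, and the integer defect is constant
  -- by connectedness.
  · have hc : ∀ h, ∃ c, ∀ x, ψ h (g +ᵥ x) - ψ (h + g) x + ψ g x = c := fun h =>
      exists_eq_const_of_coe_eq
        ⟨fun x => ψ h (g +ᵥ x) - ψ (h + g) x + ψ g x,
          (((ψ h).continuous.comp (continuous_const_vadd g)).sub (ψ (h + g)).continuous).add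
            (ψ g).continuous⟩ 0 fun x => by
          simp only [ContinuousMap.coe_mk, AddCircle.coe_add, AddCircle.coe_sub, hψ', vadd_vadd]
          abel
    choose c hc using hc
    refine ⟨(((∑ h, c h) / n : ℝ) : UnitAddCircle), fun x => ?_⟩
    have hβ : β (g +ᵥ x) = β x - ψ g x + (∑ h, c h) / n := by
      have h1 : ∑ h, ψ h (g +ᵥ x) = ∑ h, ψ (h + g) x - n * ψ g x + ∑ h, c h := by
        rw [Finset.sum_congr rfl fun h _ => show ψ h (g +ᵥ x) = ψ (h + g) x - ψ g x + c h by
          rw [← hc h x]; ring]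
        simp [Finset.sum_add_distrib, Finset.sum_sub_distrib]
      have h2 : ∑ h, ψ (h + g) x = ∑ h, ψ h x := Equiv.sum_comp (Equiv.addRight g) fun h => ψ h x
      simp only [β, ContinuousMap.coe_mk, h1, h2]
      field_simp
    change u (g +ᵥ x) + (β (g +ᵥ x) : UnitAddCircle) = u x + (β x : UnitAddCircle) + _
    rw [hβ, AddCircle.coe_add, AddCircle.coe_sub, hψ']
    abel

/-- A generator of the group of maps to the circle modulo liftable maps can be chosen to be
equivariant with respect to an injective character. -/
theorem exists_equivariant_generator (hn : 2 ≤ n)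
    (hw : ∀ (h : ZMod n) x, w (h +ᵥ x) = ZMod.toAddCircle h + w x)
    (hu : ∀ u₀ : C(Γ, UnitAddCircle), ∃ k : ℤ, u₀ - k • u ∈ liftable Γ) :
    ∃ φ : C(Γ, UnitAddCircle), (∀ u₀ : C(Γ, UnitAddCircle), ∃ k : ℤ, u₀ - k • φ ∈ liftable Γ) ∧
      ∀ h : ZMod n, h ≠ 0 → ∃ a : UnitAddCircle, a ≠ 0 ∧ n • a = 0 ∧
        ∀ x, φ (h +ᵥ x) = φ x + a := by
  obtain ⟨φ, hφu, hφ⟩ := exists_averaged_map fun h => translate_sub_mem_liftable hn hw hu h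
  have hgen : ∀ u₀ : C(Γ, UnitAddCircle), ∃ k : ℤ, u₀ - k • φ ∈ liftable Γ := by
    intro u₀
    obtain ⟨k, hk⟩ := hu u₀
    refine ⟨k, ?_⟩
    have := (liftable Γ).sub_mem hk ((liftable Γ).zsmul_mem hφu k)
    convert this using 1
    module
  refine ⟨φ, hgen, fun h hh => ?_⟩
  obtain ⟨a, ha⟩ := hφ h
  refine ⟨a, ?_, nsmul_eq_zero_of_vadd ha, ha⟩
  -- If `φ` were invariant under `h`, the real lift of `w - k • φ` would change by `h / n` modulo
  -- integers, forcing `h = 0`.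
  rintro rfl
  obtain ⟨k, θ, hθ⟩ := hgen w
  have hθ' : ∀ x, (θ x : UnitAddCircle) = w x - k • φ x := fun x => (hθ x).symm
  refine hh (ZMod.toAddCircle_eq_zero.1 (eq_zero_of_coe_vadd θ (h := h) fun x => ?_))
  rw [hθ', hθ', hw, ha, add_zero]
  abel

end Circle

end BorsukUlam

/-! ### An explicit loop in the wedge separating the cosets of the `n`-torsion. -/

namespace BorsukUlam

open Set Topology Filter

theorem unitAddCircle_coe_eq_coe_iff {x y : ℝ} :
    (x : UnitAddCircle) = y ↔ ∃ N : ℤ, x - y = N := by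
  rw [← sub_eq_zero, ← AddCircle.coe_sub, AddCircle.coe_eq_zero_iff]
  simp only [zsmul_eq_mul, mul_one, eq_comm]

/-- The function that increases from `0` to `1` on the interval `[i / 6, (i + 1) / 6]`. -/
noncomputable def ramp (i s : ℝ) : ℝ := max 0 (min 1 (6 * s - i))

theorem continuous_ramp (i : ℝ) : Continuous (ramp i) := by
  unfold ramp; fun_prop

theorem ramp_of_le {i s : ℝ} (h : 6 * s ≤ i) : ramp i s = 0 :=
  max_eq_left ((min_le_right _ _).trans (by linarith))

theorem ramp_of_ge {i s : ℝ} (h : i + 1 ≤ 6 * s) : ramp i s = 1 := by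
  rw [ramp, min_eq_left (by linarith), max_eq_right zero_le_one]

theorem ramp_of_mem {i s : ℝ} (h : i ≤ 6 * s) (h' : 6 * s ≤ i + 1) : ramp i s = 6 * s - i := by
  rw [ramp, min_eq_right (by linarith), max_eq_right (by linarith)]

theorem ramp_nonneg (i s : ℝ) : 0 ≤ ramp i s := le_max_left _ _

theorem ramp_le_one (i s : ℝ) : ramp i s ≤ 1 := max_le zero_le_one (min_le_left _ _)

theorem ramp_anti {i j : ℝ} (h : i ≤ j) (s : ℝ) : ramp j s ≤ ramp i s :=
  max_le_max le_rfl (min_le_min le_rfl (by linarith))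

/-- The periodic function that drops from `0` to `-1` and later returns to `0` in each period. -/
noncomputable def dip (r : ℝ) : ℝ := ramp 3 (Int.fract r) - ramp 0 (Int.fract r)

theorem continuous_dip : Continuous dip :=
  ContinuousOn.comp_fract'' (f := fun s => ramp 3 s - ramp 0 s)
    ((continuous_ramp 3).sub (continuous_ramp 0)).continuousOn (by norm_num [ramp])

theorem dip_nonpos (r : ℝ) : dip r ≤ 0 := sub_nonpos.2 (ramp_anti (by norm_num) _)

theorem neg_one_le_dip (r : ℝ) : -1 ≤ dip r := by
  unfold dip
  linarith [ramp_nonneg 3 (Int.fract r), ramp_le_one 0 (Int.fract r)]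

section Loop

variable (n : ℕ) (k : ℤ)

/-- The signed position of the moving point during all periods but the last: positive on the
interval, negative on the circle. -/
noncomputable def position (t : ℝ) : ℝ := n / (n - 1) * t + dip (n * t)

/-- The time elapsed in the last period. -/
def lastTime (t : ℝ) : ℝ := n * t - (n - 1)

/-- The angle of a loop of degree `k` in the wedge of a circle and an interval. -/
noncomputable def loopAngle (t : ℝ) : ℝ :=
  if t ≤ (n - 1) / n then max 0 (-position n t) / 2
  else -ramp 2 (lastTime n t) / 4 - ramp 4 (lastTime n t) + (k + 5 / 4) * ramp 5 (lastTime n t)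

/-- The height of a loop of degree `k` in the wedge of a circle and an interval. -/
noncomputable def loopHeight (t : ℝ) : ℝ :=
  if t ≤ (n - 1) / n then max 0 (position n t) else 1 - ramp 1 (lastTime n t)

variable {n} (hn : 2 ≤ n)

include hn in
theorem position_last : position n ((n - 1) / n) = 1 := by
  have h2 : (2 : ℝ) ≤ n := by exact_mod_cast hn
  have h0 : (n : ℝ) ≠ 0 := by linarith
  have h1 : (n : ℝ) - 1 ≠ 0 := by linarith
  have hd : dip (n * ((n - 1) / n)) = 0 := by
    rw [mul_div_cancel₀ _ h0, dip, show ((n : ℝ) - 1) = ((n - 1 : ℤ) : ℝ) by push_cast; rfl,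
      Int.fract_intCast]
    norm_num [ramp]
  rw [position, hd, add_zero]
  field_simp

include hn in
theorem lastTime_last : lastTime n ((n - 1) / n) = 0 := by
  have h2 : (2 : ℝ) ≤ n := by exact_mod_cast hn
  rw [lastTime, mul_div_cancel₀ _ (by linarith), sub_self]

theorem loopAngle_of_le {t : ℝ} (ht : t ≤ (n - 1) / n) :
    loopAngle n k t = max 0 (-position n t) / 2 := if_pos ht

theorem loopHeight_of_le {t : ℝ} (ht : t ≤ (n - 1) / n) :
    loopHeight n t = max 0 (position n t) := if_pos ht

include hn in
theorem loopAngle_of_ge {t : ℝ} (ht : (n - 1) / n ≤ t) : loopAngle n k t =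
    -ramp 2 (lastTime n t) / 4 - ramp 4 (lastTime n t) + (k + 5 / 4) * ramp 5 (lastTime n t) := by
  rcases ht.eq_or_lt with rfl | ht
  · rw [loopAngle_of_le k le_rfl, position_last hn, lastTime_last hn]
    norm_num [ramp]
  · exact if_neg (not_le.2 ht)

include hn in
theorem loopHeight_of_ge {t : ℝ} (ht : (n - 1) / n ≤ t) :
    loopHeight n t = 1 - ramp 1 (lastTime n t) := by
  rcases ht.eq_or_lt with rfl | ht
  · rw [loopHeight_of_le le_rfl, position_last hn, lastTime_last hn]
    norm_num [ramp]
  · exact if_neg (not_le.2 ht)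

theorem continuous_position : Continuous (position n) :=
  (continuous_const.mul continuous_id).add
    (continuous_dip.comp (continuous_const.mul continuous_id))

theorem continuous_lastTime : Continuous (lastTime n) := by
  unfold lastTime; fun_prop

include hn in
theorem continuous_loopAngle : Continuous (loopAngle n k) := by
  have hr := fun i => (continuous_ramp i).comp (continuous_lastTime (n := n))
  simp only [Function.comp_def] at hr
  refine Continuous.if_le ?_ ?_ continuous_id continuous_const ?_
  · exact (continuous_const.max continuous_position.neg).div_const _
  · exact (((hr 2).neg.div_const _).sub (hr 4)).add (continuous_const.mul (hr 5))
  · rintro t ht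
    rw [← loopAngle_of_le k ht.le, loopAngle_of_ge k hn ht.ge]

include hn in
theorem continuous_loopHeight : Continuous (loopHeight n) := by
  have hr := fun i => (continuous_ramp i).comp (continuous_lastTime (n := n))
  simp only [Function.comp_def] at hr
  refine Continuous.if_le ?_ ?_ continuous_id continuous_const ?_
  · exact continuous_const.max continuous_position
  · exact continuous_const.sub (hr 1)
  · rintro t ht
    rw [← loopHeight_of_le ht.le, loopHeight_of_ge hn ht.ge]

include hn in
theorem last_bounds : (0 : ℝ) < (n - 1) / n ∧ ((n : ℝ) - 1) / n ≤ 1 := by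
  have h2 : (2 : ℝ) ≤ n := by exact_mod_cast hn
  exact ⟨div_pos (by linarith) (by linarith), (div_le_one (by linarith)).2 (by linarith)⟩

theorem position_zero : position n 0 = 0 := by norm_num [position, dip, ramp]

include hn in
theorem loopAngle_zero : loopAngle n k 0 = 0 := by
  rw [loopAngle_of_le k (last_bounds hn).1.le, position_zero]
  simp

include hn in
theorem loopHeight_zero : loopHeight n 0 = 0 := by
  rw [loopHeight_of_le (last_bounds hn).1.le, position_zero]
  simp

theorem lastTime_one : lastTime n 1 = 1 := by simp [lastTime]

include hn in
theorem loopAngle_one : loopAngle n k 1 = k := by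
  rw [loopAngle_of_ge k hn (last_bounds hn).2, lastTime_one]
  norm_num [ramp]

include hn in
theorem loopHeight_one : loopHeight n 1 = 0 := by
  rw [loopHeight_of_ge hn (last_bounds hn).2, lastTime_one]
  norm_num [ramp]

include hn in
theorem mul_bounds {t : ℝ} (ht : 0 ≤ t) :
    0 ≤ (n : ℝ) / (n - 1) * t ∧ (t ≤ (n - 1) / n → (n : ℝ) / (n - 1) * t ≤ 1) ∧
      (t < (n - 1) / n → (n : ℝ) / (n - 1) * t < 1) ∧ (0 < t → 0 < (n : ℝ) / (n - 1) * t) := by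
  have h2 : (2 : ℝ) ≤ n := by exact_mod_cast hn
  have h0 : (0 : ℝ) < n := by linarith
  have h1 : (0 : ℝ) < n - 1 := by linarith
  have he : (n : ℝ) / (n - 1) * ((n - 1) / n) = 1 := by field_simp
  have hp : (0 : ℝ) < n / (n - 1) := div_pos h0 h1
  refine ⟨by positivity, fun h => ?_, fun h => ?_, fun h => by positivity⟩
  · exact (mul_le_mul_of_nonneg_left h hp.le).trans_eq he
  · exact (mul_lt_mul_of_pos_left h hp).trans_eq he

include hn in
theorem loopHeight_mem {t : ℝ} (ht : 0 ≤ t) : loopHeight n t ∈ unitInterval := by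
  rcases le_total t ((n - 1) / n) with h | h
  · rw [loopHeight_of_le h]
    refine ⟨le_max_left _ _, max_le zero_le_one ?_⟩
    have := (mul_bounds hn ht).2.1 h
    unfold position
    linarith [dip_nonpos (n * t)]
  · rw [loopHeight_of_ge hn h]
    constructor <;> linarith [ramp_nonneg 1 (lastTime n t), ramp_le_one 1 (lastTime n t)]

include hn in
theorem loopHeight_eq_zero_or (t : ℝ) : loopHeight n t = 0 ∨ loopAngle n k t = 0 := by
  rcases le_total t ((n - 1) / n) with h | h
  · rw [loopHeight_of_le h, loopAngle_of_le k h]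
    rcases le_total (position n t) 0 with h | h
    · exact Or.inl (max_eq_left h)
    · right
      rw [max_eq_left (by linarith), zero_div]
  · rw [loopHeight_of_ge hn h, loopAngle_of_ge k hn h]
    rcases le_total (6 * lastTime n t) 2 with h | h
    · right
      rw [ramp_of_le h, ramp_of_le (by linarith), ramp_of_le (by linarith)]
      ring
    · left
      rw [ramp_of_ge (by linarith), sub_self]

include hn in
/-- The loop does not pass through the same point at times that differ by a multiple of `1 / n`. -/
theorem loop_injective_of_lt {t t' : ℝ} (ht : 0 ≤ t) (htt : t < t') (ht' : t' < 1) {d N : ℤ}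
    (hd : n * t' = n * t + d) (hh : loopHeight n t = loopHeight n t')
    (ha : loopAngle n k t - loopAngle n k t' = N) : False := by
  have h2 : (2 : ℝ) ≤ n := by exact_mod_cast hn
  have hfr : Int.fract (n * t') = Int.fract (n * t) := by rw [hd, Int.fract_add_intCast]
  -- The angles compared below differ by less than a full turn, so equality on the circle is
  -- equality of angles.
  have hN : ∀ {x : ℝ}, x = N → -1 < x → x < 1 → x = 0 := by
    rintro x rfl h1 h2
    have h3 : -1 < N := by exact_mod_cast h1
    have h4 : N < 1 := by exact_mod_cast h2
    exact_mod_cast (by omega : N = 0)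
  obtain ⟨hp0, hp1, hp2, hp3⟩ := mul_bounds hn ht
  have hdip := dip_nonpos (n * t)
  have hdip' := neg_one_le_dip (n * t)
  rcases lt_or_ge t ((n - 1) / n) with h | h
  · have hlt := hp2 h
    rw [loopHeight_of_le h.le] at hh
    rw [loopAngle_of_le k h.le] at ha
    have hA : 0 ≤ max 0 (-position n t) ∧ max 0 (-position n t) ≤ 1 :=
      ⟨le_max_left _ _, max_le zero_le_one (by unfold position; linarith)⟩
    rcases le_total t' ((n - 1) / n) with h' | h'
    · obtain ⟨hq0, -, -, -⟩ := mul_bounds hn (ht.trans htt.le)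
      rw [loopHeight_of_le h'] at hh
      rw [loopAngle_of_le k h'] at ha
      have hdip2 := neg_one_le_dip (n * t')
      have hA' : 0 ≤ max 0 (-position n t') ∧ max 0 (-position n t') ≤ 1 :=
        ⟨le_max_left _ _, max_le zero_le_one (by unfold position; linarith)⟩
      have h0 := hN ha (by linarith [hA.1, hA'.2]) (by linarith [hA.2, hA'.1])
      -- Both times precede the last period: height and angle recover the signed position, and the
      -- dips agree, so the strictly increasing linear drift separates the points.
      have hpos : ∀ y : ℝ, y = max 0 y - max 0 (-y) := fun y => by
        rcases le_total y 0 with hy | hy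
        · rw [max_eq_left hy, max_eq_right (by linarith)]; ring
        · rw [max_eq_right hy, max_eq_left (by linarith)]; ring
      have heq : position n t = position n t' := by
        rw [hpos (position n t), hpos (position n t')]
        linarith
      have hdd : dip (n * t') = dip (n * t) := by unfold dip; rw [hfr]
      unfold position at heq
      rw [hdd] at heq
      have hpp : (0 : ℝ) < n / (n - 1) := div_pos (by linarith) (by linarith)
      have := mul_lt_mul_of_pos_left htt hpp
      linarith
    · rw [loopHeight_of_ge hn h'] at hh
      rw [loopAngle_of_ge k hn h'] at ha
      have hs : Int.fract (n * t) = lastTime n t' := by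
        rw [← hfr, Int.fract_eq_iff]
        refine ⟨?_, ?_, n - 1, ?_⟩
        · rw [div_le_iff₀ (by linarith)] at h'
          unfold lastTime
          linarith
        · unfold lastTime
          nlinarith
        · unfold lastTime
          push_cast
          ring
      have hdipe : dip (n * t) = ramp 3 (lastTime n t') - ramp 0 (lastTime n t') := by
        rw [dip, hs]
      set s := lastTime n t'
      -- The later point is in its last period and waits at height `1`, which the earlier one, with
      -- position below `1`, cannot reach.
      rcases le_total (6 * s) 1 with hs1 | hs1
      · rw [ramp_of_le hs1, sub_zero] at hh
        have : max 0 (position n t) < 1 := max_lt zero_lt_one (by unfold position; linarith)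
        linarith
      -- The earlier point is fully dipped, at an angle in `(0, 1/2]`, while the later one comes
      -- down the interval and moves to angles in `[-1/4, 0]`.
      rcases le_total (6 * s) 3 with hs3 | hs3
      · rw [ramp_of_le hs3, ramp_of_ge (by linarith)] at hdipe
        rw [ramp_of_le (i := 4) (by linarith), ramp_of_le (i := 5) (by linarith)] at ha
        have hy : 0 < -position n t ∧ -position n t ≤ 1 := by
          unfold position; constructor <;> linarith
        rw [max_eq_right hy.1.le] at ha
        have := hN ha (by linarith [ramp_nonneg 2 s, ramp_le_one 2 s])
          (by linarith [ramp_nonneg 2 s, ramp_le_one 2 s])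
        linarith [ramp_nonneg 2 s]
      -- The later point waits at angle `-1/4`; the earlier one has angle in `[0, 1/2]`.
      rcases le_total (6 * s) 4 with hs4 | hs4
      · rw [ramp_of_ge (i := 2) (by linarith), ramp_of_le (i := 4) (by linarith),
          ramp_of_le (i := 5) (by linarith)] at ha
        have := hN ha (by linarith) (by linarith)
        linarith
      · rw [ramp_of_ge (i := 3) (by linarith), ramp_of_ge (i := 0) (by linarith),
          sub_self] at hdipe
        -- The dip is over, so the earlier point is at positive height as soon as `t > 0`, while the
        -- later one circulates at height `0`.
        have htpos : 0 < t := by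
          rcases ht.eq_or_lt with rfl | h0
          · rw [mul_zero, Int.fract_zero] at hs
            linarith
          · exact h0
        have hy := hp3 htpos
        rw [ramp_of_ge (i := 1) (by linarith), sub_self] at hh
        have hle := le_max_right 0 (position n t)
        unfold position at hle hh
        linarith
  -- Two times in the last period differ by less than `1 / n`.
  · rw [div_le_iff₀ (by linarith)] at h
    have h3 : (0 : ℝ) < d := by nlinarith
    have h4 : (d : ℝ) < 1 := by nlinarith
    have h5 : 0 < d := by exact_mod_cast h3
    have h6 : d < 1 := by exact_mod_cast h4
    omega

/-- For every degree there is a map from the circle onto the wedge of a circle and an interval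
that is injective on the cosets of the subgroup of order `n`. -/
theorem exists_wedge_map (n : ℕ) (hn : 2 ≤ n) (k : ℤ) :
    ∃ (F : C(UnitAddCircle, CircleWedgeInterval)) (Θ : C(UnitAddCircle, ℝ)),
      (∀ z, (F z).1.1 = AddCircle.toCircle (k • z + (Θ z : UnitAddCircle))) ∧
      Function.Surjective F ∧ ∀ z z', n • (z - z') = 0 → F z = F z' → z = z' := by
  have h2 : (2 : ℝ) ≤ n := by exact_mod_cast hn
  -- Removing the linear part of slope `k` leaves a periodic real function, which exhibits the
  -- degree of the loop.
  let Θ : C(UnitAddCircle, ℝ) := ⟨AddCircle.liftIco 1 0 fun t => loopAngle n k t - k * t,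
    AddCircle.liftIco_zero_continuous (by simp [loopAngle_zero k hn, loopAngle_one k hn])
      ((continuous_loopAngle k hn).sub (continuous_const.mul continuous_id)).continuousOn⟩
  let B : C(UnitAddCircle, ℝ) := ⟨AddCircle.liftIco 1 0 (loopHeight n),
    AddCircle.liftIco_zero_continuous (by simp [loopHeight_zero hn, loopHeight_one hn])
      (continuous_loopHeight hn).continuousOn⟩
  have hB : ∀ t ∈ Ico (0 : ℝ) 1, B t = loopHeight n t := fun t ht =>
    AddCircle.liftIco_zero_coe_apply (f := loopHeight n) ht
  have hΘ : ∀ t ∈ Ico (0 : ℝ) 1,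
      k • (t : UnitAddCircle) + (Θ t : UnitAddCircle) = (loopAngle n k t : UnitAddCircle) := by
    intro t ht
    rw [show Θ t = loopAngle n k t - k * t from
        AddCircle.liftIco_zero_coe_apply (f := fun t => loopAngle n k t - k * t) ht,
      ← AddCircle.coe_zsmul, ← AddCircle.coe_add, zsmul_eq_mul, add_sub_cancel]
  have hBmem : ∀ z, B z ∈ unitInterval := fun z => by
    obtain ⟨t, ht, rfl⟩ := AddCircle.eq_coe_Ico z
    rw [hB t ht]
    exact loopHeight_mem hn ht.1
  have hmem : ∀ z : UnitAddCircle, (⟨B z, hBmem z⟩ : unitInterval) = 0 ∨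
      AddCircle.toCircle (k • z + (Θ z : UnitAddCircle)) = 1 := fun z => by
    obtain ⟨t, ht, rfl⟩ := AddCircle.eq_coe_Ico z
    refine (loopHeight_eq_zero_or k hn t).imp (fun h => Subtype.ext ?_) fun h => ?_
    · exact (hB t ht).trans h
    · rw [hΘ t ht, h, AddCircle.coe_zero, AddCircle.toCircle_zero]
  let F : C(UnitAddCircle, CircleWedgeInterval) :=
    ⟨fun z => ⟨(AddCircle.toCircle (k • z + (Θ z : UnitAddCircle)), ⟨B z, hBmem z⟩), hmem z⟩,
      Continuous.subtype_mk (Continuous.prodMk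
        (AddCircle.continuous_toCircle.comp ((continuous_zsmul k).add
          ((AddCircle.continuous_mk' 1).comp Θ.continuous)))
        (Continuous.subtype_mk B.continuous _)) _⟩
  have hF₁ : ∀ z, (F z).1.1 = AddCircle.toCircle (k • z + (Θ z : UnitAddCircle)) := fun z => rfl
  refine ⟨F, Θ, hF₁, ?_, ?_⟩
  · have key : ∀ s : ℝ, 0 ≤ s → s < 1 → ∃ t ∈ Ico (0 : ℝ) 1, (n - 1) / n ≤ t ∧
        lastTime n t = s := by
      intro s hs0 hs1
      have hle : ((n : ℝ) - 1) / n ≤ (s + (n - 1)) / n := by gcongr; linarith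
      refine ⟨(s + (n - 1)) / n, ⟨(last_bounds hn).1.le.trans hle, ?_⟩, hle, ?_⟩
      · rw [div_lt_one (by linarith)]; linarith
      · rw [lastTime, mul_div_cancel₀ _ (by linarith)]; ring
    rintro ⟨⟨u, v⟩, huv⟩
    rcases huv with h | h
    · obtain rfl : v = 0 := h
      obtain ⟨z, rfl⟩ := (AddCircle.homeomorphCircle (one_ne_zero' ℝ)).surjective u
      -- The angles swept in the fifth sixth of the last period; solving `-1/4 - (6 * s - 4) = r`
      -- gives the time used below.
      have hz : z ∈ ((↑) : ℝ → UnitAddCircle) '' Ico (-(5 / 4) : ℝ) (-(5 / 4) + 1) := by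
        rw [AddCircle.coe_image_Ico_eq]; trivial
      obtain ⟨r, hr, rfl⟩ := hz
      have hr0 := hr.1
      have hr1 := hr.2
      obtain ⟨t, ht, htl, hs⟩ := key ((15 / 4 - r) / 6) (by linarith) (by linarith)
      refine ⟨t, Subtype.ext (Prod.ext ?_ (Subtype.ext ?_))⟩
      · refine (hF₁ t).trans ?_
        rw [AddCircle.homeomorphCircle_apply, hΘ t ht, loopAngle_of_ge k hn htl, hs,
          ramp_of_ge (by linarith), ramp_of_mem (by linarith) (by linarith),
          ramp_of_le (by linarith)]
        refine congrArg (fun y : ℝ => AddCircle.toCircle (y : UnitAddCircle)) ?_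
        ring
      · change B t = 0
        rw [hB t ht, loopHeight_of_ge hn htl, hs, ramp_of_ge (by linarith), sub_self]
    · obtain rfl : u = 1 := h
      have hv0 := v.2.1
      have hv1 := v.2.2
      -- During the descent in the second sixth the height is `2 - 6 * s`.
      obtain ⟨t, ht, htl, hs⟩ := key ((2 - v) / 6) (by linarith) (by linarith)
      refine ⟨t, Subtype.ext (Prod.ext ?_ (Subtype.ext ?_))⟩
      · refine (hF₁ t).trans ?_
        rw [hΘ t ht, loopAngle_of_ge k hn htl, hs, ramp_of_le (by linarith),
          ramp_of_le (by linarith), ramp_of_le (by linarith)]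
        simp
      · change B t = v
        rw [hB t ht, loopHeight_of_ge hn htl, hs, ramp_of_mem (by linarith) (by linarith)]
        ring
  · intro z z' hz hF
    obtain ⟨t, ht, rfl⟩ := AddCircle.eq_coe_Ico z
    obtain ⟨t', ht', rfl⟩ := AddCircle.eq_coe_Ico z'
    rw [← AddCircle.coe_sub, ← AddCircle.coe_nsmul] at hz
    obtain ⟨d, hd⟩ := (AddCircle.coe_eq_zero_iff _).1 hz
    simp only [zsmul_eq_mul, mul_one, nsmul_eq_mul] at hd
    have hh : loopHeight n t = loopHeight n t' := by
      rw [← hB t ht, ← hB t' ht']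
      exact congrArg (fun p : CircleWedgeInterval => (p.1.2 : ℝ)) hF
    have ha : (loopAngle n k t : UnitAddCircle) = loopAngle n k t' := by
      rw [← hΘ t ht, ← hΘ t' ht']
      exact AddCircle.injective_toCircle one_ne_zero
        (congrArg (fun p : CircleWedgeInterval => p.1.1) hF)
    obtain ⟨N, hN⟩ := unitAddCircle_coe_eq_coe_iff.1 ha
    rcases lt_trichotomy t t' with hlt | rfl | hlt
    · exact (loop_injective_of_lt k hn ht.1 hlt ht'.2 (d := -d) (N := N)
        (by push_cast; linarith) hh hN).elim
    · rfl
    · exact (loop_injective_of_lt k hn ht'.1 hlt ht.2 (d := d) (N := -N)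
        (by linarith) hh.symm (by push_cast; linarith)).elim

end Loop

end BorsukUlam

/-! ### Assembling the representative and the main theorem. -/

namespace BorsukUlam

open Set Topology

/-- If the maps from a space to the circle are, modulo liftable ones, multiples of a map that is
equivariant with respect to an injective character, then every map to the wedge of a circle and an
interval is homotopic, relative to any given point, to one that is injective on orbits. -/
theorem exists_homotopicRel_injective_on_orbits {Γ : Type*} [TopologicalSpace Γ] {n : ℕ}
    (hn : 2 ≤ n) [AddAction (ZMod n) Γ] (φ : C(Γ, UnitAddCircle))
    (hgen : ∀ u₀ : C(Γ, UnitAddCircle), ∃ k : ℤ, u₀ - k • φ ∈ liftable Γ)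
    (hφ : ∀ h : ZMod n, h ≠ 0 → ∃ a : UnitAddCircle, a ≠ 0 ∧ n • a = 0 ∧
      ∀ x, φ (h +ᵥ x) = φ x + a) (g : C(Γ, CircleWedgeInterval)) (x₁ : Γ) :
    ∃ f : C(Γ, CircleWedgeInterval), f x₁ = g x₁ ∧ g.HomotopicRel f {x₁} ∧
      ∀ (h₁ h₂ : ZMod n) (x : Γ), h₁ ≠ h₂ → f (h₁ +ᵥ x) ≠ f (h₂ +ᵥ x) := by
  let c := AddCircle.homeomorphCircle (one_ne_zero' ℝ)
  let u : C(Γ, UnitAddCircle) := ⟨fun x => c.symm (g x).1.1, by fun_prop⟩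
  have hu : ∀ x, (g x).1.1 = AddCircle.toCircle (u x) := fun x => by
    rw [← AddCircle.homeomorphCircle_apply (one_ne_zero' ℝ)]
    exact (c.apply_symm_apply _).symm
  obtain ⟨k, θ₀, hθ₀⟩ := hgen u
  have hθ₀' : ∀ x, u x = k • φ x + (θ₀ x : UnitAddCircle) := fun x => by
    rw [← hθ₀ x]
    exact (add_sub_cancel _ _).symm
  obtain ⟨F, Θ, hFΘ, hFs, hFi⟩ := exists_wedge_map n hn k
  obtain ⟨z₁, hz₁⟩ := hFs (g x₁)
  obtain ⟨r, hr⟩ := QuotientAddGroup.mk_surjective (k • (z₁ - φ x₁))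
  have hr' : (r : UnitAddCircle) = k • (z₁ - φ x₁) := hr
  -- A rotation of `φ` sending `x₁` to a preimage of `g x₁` under `F`; the translation constants are
  -- unaffected.
  let ξ : C(Γ, UnitAddCircle) := ⟨fun x => φ x - φ x₁ + z₁, by fun_prop⟩
  let θ : C(Γ, ℝ) := ⟨fun x => Θ (ξ x) - θ₀ x + r, by fun_prop⟩
  have hf : ∀ x, (F (ξ x)).1.1 = (g x).1.1 * AddCircle.toCircle (θ x : UnitAddCircle) := by
    intro x
    rw [hFΘ, hu, ← AddCircle.toCircle_add, hθ₀']
    congr 1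
    simp only [θ, ξ, ContinuousMap.coe_mk, AddCircle.coe_add, AddCircle.coe_sub, hr']
    module
  have hf₁ : F (ξ x₁) = g x₁ := by
    simp only [ξ, ContinuousMap.coe_mk, sub_self, zero_add, hz₁]
  have hθ₁ : AddCircle.toCircle (θ x₁ : UnitAddCircle) = 1 := by
    have := hf x₁
    rw [hf₁] at this
    exact left_eq_mul.1 this
  refine ⟨F.comp ξ, hf₁, ?_, fun h₁ h₂ x hh heq => ?_⟩
  · refine homotopicRel_of_circle_eq_mul_exp (f := g) (g := F.comp ξ)
      -- By `hθ₁` the number `θ x₁` is an integer, so subtracting it does not change the exponential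
      -- and makes the homotopy fix `x₁`.
      ⟨fun x => 2 * Real.pi * (θ x - θ x₁), by fun_prop⟩ (fun x => ?_) ?_
    · change (F (ξ x)).1.1 = _
      rw [hf]
      congr 1
      have h1 := AddCircle.toCircle_apply_mk (T := 1) (θ x - θ x₁)
      rw [AddCircle.coe_sub, sub_eq_add_neg, AddCircle.toCircle_add, AddCircle.toCircle_neg, hθ₁,
        inv_one, mul_one, div_one] at h1
      exact h1
    · rintro x rfl
      exact ⟨by simp, hf₁.symm⟩
  · obtain ⟨a, ha0, hna, ha⟩ := hφ (h₁ - h₂) (sub_ne_zero.2 hh)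
    have hξ : ξ (h₁ +ᵥ x) - ξ (h₂ +ᵥ x) = a := by
      have := ha (h₂ +ᵥ x)
      rw [vadd_vadd, sub_add_cancel] at this
      simp only [ξ, ContinuousMap.coe_mk, this]
      abel
    have := hFi _ _ (by rw [hξ, hna]) heq
    rw [this, sub_self] at hξ
    exact ha0 hξ.symm

end BorsukUlam

theorem mainTheorem1 (n : ℕ) (hn : 2 ≤ n)
    {Γ : Type*} [TopologicalSpace Γ] [T2Space Γ] [ConnectedSpace Γ]
    [Topology.CWComplex (Set.univ : Set Γ)] [BorsukUlam.IsFiniteGraph Γ]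
    (hχ : BorsukUlam.graphEulerChar Γ = 0)
    [AddAction (ZMod n) Γ] [ContinuousConstVAdd (ZMod n) Γ]
    (hfree : ∀ (h : ZMod n) (x : Γ), h +ᵥ x = x → h = 0) :
    (∀ α : BorsukUlam.FreeHomotopyClass Γ BorsukUlam.CircleWedgeInterval,
      ¬ α.HasBorsukUlam (ZMod n)) ∧
    (∀ (x₁ : Γ) (y₁ : BorsukUlam.CircleWedgeInterval)
      (α : BorsukUlam.BasedHomotopyClass x₁ y₁), ¬ α.HasBorsukUlam (ZMod n)) := by
  have : NeZero n := ⟨by omega⟩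
  obtain ⟨P⟩ := BorsukUlam.exists_edgePresentation (Γ := Γ)
  have hfin := Topology.RelCWComplex.finite_cells_of_finite (C := (Set.univ : Set Γ))
  have hcell : ∀ m, Finite (Topology.RelCWComplex.cell (Set.univ : Set Γ) m) := fun m =>
    Finite.of_injective (Sigma.mk m) sigma_mk_injective
  have := hcell 0
  have := hcell 1
  have hcard : Nat.card (Topology.RelCWComplex.cell (Set.univ : Set Γ) 1)
      ≤ Nat.card (Topology.RelCWComplex.cell (Set.univ : Set Γ) 0) := by
    unfold BorsukUlam.graphEulerChar at hχ
    omega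
  obtain ⟨u, hu⟩ := P.exists_generator hcard
  obtain ⟨w, hw⟩ := P.exists_equivariant_map hfree
  obtain ⟨φ, hgen, hφ⟩ := BorsukUlam.exists_equivariant_generator hn hw hu
  have key := BorsukUlam.exists_homotopicRel_injective_on_orbits hn φ hgen hφ
  refine ⟨fun α hα => ?_, fun x₁ y₁ α hα => ?_⟩
  · obtain ⟨g, rfl⟩ := Quotient.exists_rep α
    obtain ⟨x₁⟩ := (inferInstance : Nonempty Γ)
    obtain ⟨f, -, hgf, hf⟩ := key g x₁
    obtain ⟨h₁, h₂, x, hne, heq⟩ := hα f (Quotient.sound hgf.homotopic.symm)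
    exact hf h₁ h₂ x hne heq
  · obtain ⟨⟨g, hg⟩, rfl⟩ := Quotient.exists_rep α
    obtain ⟨f, hf₁, hgf, hf⟩ := key g x₁
    obtain ⟨h₁, h₂, x, hne, heq⟩ := hα ⟨f, hf₁.trans hg⟩ (Quotient.sound hgf.symm)
    exact hf h₁ h₂ x hne heq
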